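/- All manifolds are smooth, Hausdorff and second countable. Let $k\in\{1,2\}$ and let $\bar M$ be an oriented manifold of dimension $6+k$ with a $(k+1)$-fold vector cross product, that is, with a smooth pseudo-Riemannian metric $\langle\cdot,\cdot\rangle$ and a smooth tensor field $X$ that is on every tangent space a multilinear map $X:(T_y\bar M)^{k+1}\to T_y\bar M$ satisfying $$\langle X(w_1,\dots,w_{k+1}),w_i\rangle=0\quad(1\le i\le k+1),\qquad \langle X(w_1,\dots,w_{k+1}),X(w_1,\dots,w_{k+1})\rangle=\det(\langle w_i,w_j\rangle).$$ Let $M$ be an oriented $6$-manifold and $f:M\to\bar M$ an immersion with normal bundle $\nu=(df(TM))^\perp$. Suppose that the restriction of $\langle\cdot,\cdot\rangle$ to every fibre of $\nu$ is positive definite, where for $k=2$ it may also be negative definite. Suppose further that $\nu$ contains a trivial line bundle, that is, there is an injective homomorphism of smooth vector bundles $M\times\mathbb R\to\nu$. Orient $\nu$ so that a positively oriented frame of $\nu$ followed by a positively oriented frame of $TM$ is a positively oriented frame of $T\bar M$. Then there is a smooth almost complex structure $J$ on $M$ (Gray's almost complex structure) such that, identifying $v\in T_xM$ with $df(v)$,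 $$J_x(v)=-X(a_1,\dots,a_k,v)$$ for all $x\in M$, $v\in T_xM$ and every oriented orthonormal basis $a_1,\dots,a_k$ of $\nu_x$ (orthonormal means $\langle a_i,a_j\rangle=0$ for $i\neq j$ and $|\langle a_i,a_i\rangle|=1$). Moreover, for every such $J$ the first Chern class $c_1(M,J)\in H^2(M;\mathbb Z)$ vanishes. -/

import Mathlib

open CategoryTheory TopologicalSpace Opposite Bundle
open scoped Manifold ContDiff

noncomputable section
namespace GrayChern
universe u

/-- Sheaves of abelian groups on a topological space. -/
abbrev AbSheaf (X : TopCat.{u}) :=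
  CategoryTheory.Sheaf (Opens.grothendieckTopology X) AddCommGrpCat.{u}

/-- A local condition on families `x ↦ f x ∈ T x` (with every `T x` an abelian group) that is stable
under the pointwise group operations. -/
structure AddLocalPredicate (X : TopCat.{u}) (T : X → Type) [∀ x, AddCommGroup (T x)] extends
    TopCat.LocalPredicate T where
  zero_mem : ∀ U : Opens X, pred (U := U) 0
  add_mem : ∀ {U : Opens X} {f g : ∀ x : U, T x}, pred f → pred g → pred (f + g)
  neg_mem : ∀ {U : Opens X} {f : ∀ x : U, T x}, pred f → pred (-f)

namespace AddLocalPredicate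
variable {X : TopCat.{u}} {T T' T'' : X → Type} [∀ x, AddCommGroup (T x)]
  [∀ x, AddCommGroup (T' x)] [∀ x, AddCommGroup (T'' x)]

/-- The families over `U` that satisfy the condition. -/
def sections (P : AddLocalPredicate X T) (U : Opens X) : AddSubgroup (∀ x : U, T x) where
  carrier := {f | P.pred f}
  zero_mem' := P.zero_mem U
  add_mem' := P.add_mem
  neg_mem' := P.neg_mem

/-- The sheaf of abelian groups of all families that satisfy the condition. -/
def sheaf (P : AddLocalPredicate X T) : AbSheaf X where
  obj :=
    { obj := fun U => AddCommGrpCat.of (P.sections U.unop)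
      map := fun i => AddCommGrpCat.ofHom
        { toFun := fun f => ⟨fun x => f.1 (i.unop x), P.res i.unop f.1 f.2⟩
          map_zero' := rfl
          map_add' := fun _ _ => rfl } }
  property := by
    rw [CategoryTheory.Presheaf.isSheaf_iff_isSheaf_forget _ _ (CategoryTheory.forget AddCommGrpCat)]
    exact (TopCat.subsheafToTypes P.toLocalPredicate).property

/-- The map of sheaves induced by fibrewise homomorphisms. -/
def sheafMap (P : AddLocalPredicate X T) (Q : AddLocalPredicate X T')
    (φ : ∀ x, T x →+ T' x)
    (hφ : ∀ (U : Opens X) (f : ∀ x : U, T x), P.pred f → Q.pred fun x : U => φ x (f x)) :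
    P.sheaf ⟶ Q.sheaf where
  hom :=
    { app := fun U => AddCommGrpCat.ofHom
        { toFun := fun f => ⟨fun x => φ x (f.1 x), hφ _ f.1 f.2⟩
          map_zero' := Subtype.ext (funext fun x => map_zero (φ x))
          map_add' := fun _ _ => Subtype.ext (funext fun x => map_add (φ x) _ _) }
      naturality := fun _ _ _ => rfl }

/-- The complex of sheaves induced by two composable fibrewise homomorphisms. -/
def shortComplex (P : AddLocalPredicate X T) (Q : AddLocalPredicate X T')
    (R : AddLocalPredicate X T'') (φ : ∀ x, T x →+ T' x) (ψ : ∀ x, T' x →+ T'' x)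
    (hφ : ∀ (U : Opens X) (f : ∀ x : U, T x), P.pred f → Q.pred fun x : U => φ x (f x))
    (hψ : ∀ (U : Opens X) (f : ∀ x : U, T' x), Q.pred f → R.pred fun x : U => ψ x (f x))
    (h0 : ∀ x t, ψ x (φ x t) = 0) : ShortComplex (AbSheaf X) :=
  ShortComplex.mk (sheafMap P Q φ hφ) (sheafMap Q R ψ hψ) (by
    apply ObjectProperty.hom_ext
    apply NatTrans.ext
    funext U
    apply AddCommGrpCat.ext
    intro f
    exact Subtype.ext (funext fun x => h0 _ _))

/-- A criterion for short exactness: the second map only has to be surjective locally. -/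
theorem shortComplex_shortExact (P : AddLocalPredicate X T) (Q : AddLocalPredicate X T')
    (R : AddLocalPredicate X T'') (φ : ∀ x, T x →+ T' x) (ψ : ∀ x, T' x →+ T'' x)
    (hφ : ∀ (U : Opens X) (f : ∀ x : U, T x), P.pred f → Q.pred fun x : U => φ x (f x))
    (hψ : ∀ (U : Opens X) (f : ∀ x : U, T' x), Q.pred f → R.pred fun x : U => ψ x (f x))
    (h0 : ∀ x t, ψ x (φ x t) = 0)
    (hinj : ∀ x, Function.Injective (φ x))
    (hex : ∀ (U : Opens X) (f : ∀ x : U, T' x), Q.pred f → (∀ x : U, ψ x (f x) = 0) →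
      ∃ g : ∀ x : U, T x, P.pred g ∧ ∀ x : U, φ x (g x) = f x)
    (hsurj : ∀ (U : Opens X) (f : ∀ x : U, T'' x), R.pred f → ∀ x : U,
      ∃ (V : Opens X) (i : V ⟶ U) (g : ∀ y : V, T' y), x.1 ∈ V ∧ Q.pred g ∧
        ∀ y : V, ψ y (g y) = f (i y)) :
    (shortComplex P Q R φ ψ hφ hψ h0).ShortExact := by
  have hm : Mono (shortComplex P Q R φ ψ hφ hψ h0).f := by
    refine (CategoryTheory.Sheaf.Hom.mono_iff_presheaf_mono _ _ _).mpr
      ((NatTrans.mono_iff_mono_app _).mpr fun U => (AddCommGrpCat.mono_iff_injective _).mpr ?_)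
    intro f g h
    apply Subtype.ext
    funext x
    apply hinj
    exact congrFun (congrArg Subtype.val h) x
  refine ShortComplex.ShortExact.mk' ?_ hm ?_
  · refine (TopCat.Sheaf.exact_iff_stalkFunctor_map_exact (C := AddCommGrpCat.{u})
      (shortComplex P Q R φ ψ hφ hψ h0)).2 fun x => ?_
    rw [ShortComplex.ab_exact_iff]
    intro s hs
    obtain ⟨U, hx, f, rfl⟩ := TopCat.Presheaf.exists_germ_eq _ s
    have h1 : TopCat.Presheaf.germ R.sheaf.obj U x hx ((sheafMap Q R ψ hψ).hom.app (op U) f) =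
        TopCat.Presheaf.germ R.sheaf.obj U x hx 0 := by
      rw [map_zero]
      refine Eq.trans ?_ hs
      exact (TopCat.Presheaf.stalkFunctor_map_germ_apply U x hx (sheafMap Q R ψ hψ).hom f).symm
    obtain ⟨W, hW, i₁, i₂, h2⟩ := TopCat.Presheaf.germ_eq R.sheaf.obj x hx hx _ _ h1
    obtain ⟨g, hg, h3⟩ := hex W (fun y => f.1 (i₁ y)) (Q.res i₁ f.1 f.2)
      fun y => congrFun (congrArg Subtype.val h2) y
    refine ⟨TopCat.Presheaf.germ P.sheaf.obj W x hW ⟨g, hg⟩, ?_⟩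
    refine (TopCat.Presheaf.stalkFunctor_map_germ_apply W x hW (sheafMap P Q φ hφ).hom _).trans ?_
    have h4 : (sheafMap P Q φ hφ).hom.app (op W) ⟨g, hg⟩ = Q.sheaf.obj.map i₁.op f :=
      Subtype.ext (funext h3)
    rw [h4]
    exact TopCat.Presheaf.germ_res_apply _ _ _ _ _
  · refine (TopCat.Sheaf.isLocallySurjective_iff_epi (C := AddCommGrpCat.{u})
      (shortComplex P Q R φ ψ hφ hψ h0).g).1 ?_
    refine (TopCat.Presheaf.isLocallySurjective_iff (sheafMap Q R ψ hψ).hom).2 fun U f x hx => ?_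
    obtain ⟨V, i, g, hV, hg, h⟩ := hsurj U f.1 f.2 ⟨x, hx⟩
    exact ⟨V, i.le, ⟨⟨g, hg⟩, Subtype.ext (funext h)⟩, hV⟩

end AddLocalPredicate

/-- The sheaf of continuous functions with values in a topological abelian group `A`. -/
def continuousPred (X : TopCat.{u}) (A : Type) [AddCommGroup A] [TopologicalSpace A]
    [IsTopologicalAddGroup A] : AddLocalPredicate X (fun _ => A) where
  toLocalPredicate := TopCat.continuousLocal X A
  zero_mem _ := continuous_const
  add_mem hf hg := Continuous.add hf hg
  neg_mem hf := Continuous.neg hf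

/-- The constant sheaf `ℤ`, as the sheaf of continuous (that is, locally constant) functions to the
discrete group `ℤ`. -/
def intSheaf (X : TopCat.{u}) : AbSheaf X := (continuousPred X ℤ).sheaf

/-- The homomorphism `z ↦ exp (2πiz)` from `ℂ` to `ℂˣ`; `ℂˣ` is written additively. -/
def expHom : ℂ →+ Additive ℂˣ where
  toFun z := Additive.ofMul (Units.mk0 (Complex.exp (2 * Real.pi * Complex.I * z))
    (Complex.exp_ne_zero _))
  map_zero' := by
    apply Additive.toMul.injective
    ext
    simp
  map_add' z w := by
    apply Additive.toMul.injective
    ext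
    simp [mul_add, Complex.exp_add]

theorem coe_expHom (z : ℂ) :
    ((expHom z).toMul : ℂ) = Complex.exp (2 * Real.pi * Complex.I * z) := rfl

theorem expHom_eq_zero_iff (z : ℂ) : expHom z = 0 ↔ ∃ n : ℤ, (n : ℂ) = z := by
  have h : (2 * (Real.pi : ℂ) * Complex.I) ≠ 0 := Complex.two_pi_I_ne_zero
  rw [← Additive.toMul.injective.eq_iff, Units.ext_iff, coe_expHom, toMul_zero, Units.val_one,
    Complex.exp_eq_one_iff]
  refine exists_congr fun n => ⟨fun e => ?_, fun e => ?_⟩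
  · apply mul_left_cancel₀ h
    rw [e]; ring
  · rw [← e]; ring

theorem continuous_toUnits_iff {Y : Type*} [TopologicalSpace Y] (f : Y → Additive ℂˣ) :
    Continuous f ↔ Continuous fun y => ((f y).toMul : ℂ) :=
  Units.isEmbedding_val₀.continuous_iff (f := fun y => (f y).toMul)

theorem continuous_expHom : Continuous expHom := by
  rw [continuous_toUnits_iff]
  simp only [coe_expHom]
  fun_prop

/-- The exponential sequence `0 → ℤ → C(-, ℂ) → C(-, ℂˣ) → 0`. -/
def expSequence (X : TopCat.{u}) : ShortComplex (AbSheaf X) :=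
  AddLocalPredicate.shortComplex (continuousPred X ℤ) (continuousPred X ℂ)
    (continuousPred X (Additive ℂˣ)) (fun _ => Int.castAddHom ℂ) (fun _ => expHom)
    (fun _ _ hf => continuous_of_discreteTopology.comp hf)
    (fun _ _ hf => continuous_expHom.comp hf)
    (fun _ n => (expHom_eq_zero_iff _).2 ⟨n, rfl⟩)

theorem expSequence_shortExact (X : TopCat.{u}) : (expSequence X).ShortExact := by
  apply AddLocalPredicate.shortComplex_shortExact
  · intro _
    exact Int.cast_injective
  · intro U f hf h
    choose n hn using fun x => (expHom_eq_zero_iff _).1 (h x)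
    refine ⟨n, ?_, hn⟩
    have h1 : Topology.IsEmbedding ((↑) : ℤ → ℝ) := Int.isClosedEmbedding_coe_real.isEmbedding
    refine h1.continuous_iff.2 ?_
    have h2 : ((↑) : ℤ → ℝ) ∘ n = fun x => (f x).re := by
      funext x
      rw [← hn x]
      simp
    rw [h2]
    exact Complex.continuous_re.comp hf
  · intro U f hf x
    have hf' : Continuous fun y : U => ((f y).toMul : ℂ) := (continuous_toUnits_iff f).1 hf
    let g : U → ℂ := fun y => ((f y).toMul : ℂ) / ((f x).toMul : ℂ)
    have hg : Continuous g := hf'.div_const _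
    have hgx : g x = 1 := div_self (Units.ne_zero _)
    obtain ⟨W, hW, hWo, hxW⟩ := eventually_nhds_iff.1
      (hg.continuousAt.eventually (Complex.isOpen_slitPlane.mem_nhds
        (by rw [hgx]; exact Complex.one_mem_slitPlane)))
    let V : Opens X := ⟨Subtype.val '' W, U.isOpen.isOpenMap_subtype_val W hWo⟩
    have hVU : V ≤ U := by
      rintro _ ⟨y, -, rfl⟩
      exact y.2
    have hVW : ∀ y : V, (⟨y, hVU y.2⟩ : U) ∈ W := by
      rintro ⟨_, ⟨y, hy, rfl⟩⟩
      exact hy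
    refine ⟨V, homOfLE hVU, fun y => (Complex.log (g ⟨y, hVU y.2⟩) +
      Complex.log ((f x).toMul : ℂ)) / (2 * Real.pi * Complex.I), ⟨x, hxW, rfl⟩, ?_, ?_⟩
    · refine Continuous.div_const (Continuous.add ?_ continuous_const) _
      have h1 : Continuous fun y : V => g ⟨y, hVU y.2⟩ :=
        hg.comp (Continuous.subtype_mk continuous_subtype_val _)
      exact continuous_iff_continuousAt.2 fun y => h1.continuousAt.clog (hW _ (hVW y))
    · intro y
      apply Additive.toMul.injective
      ext
      rw [coe_expHom, mul_div_cancel₀ _ Complex.two_pi_I_ne_zero, Complex.exp_add,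
        Complex.exp_log, Complex.exp_log (Units.ne_zero _)]
      · exact div_mul_cancel₀ _ (Units.ne_zero _)
      · exact div_ne_zero (Units.ne_zero _) (Units.ne_zero _)

/-- A smooth almost complex structure on a 6-manifold: a smooth section `J` of `End(TM)`, `J² = -1`. -/
structure AlmostComplexStructure (M : Type u) [TopologicalSpace M]
    [ChartedSpace (EuclideanSpace ℝ (Fin 6)) M] [IsManifold (𝓡 6) ∞ M] where
  toFun : ∀ x : M, TangentSpace (𝓡 6) x →L[ℝ] TangentSpace (𝓡 6) x
  sq : ∀ (x : M) (v : TangentSpace (𝓡 6) x), toFun x (toFun x v) = -v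
  smooth : ContMDiff (𝓡 6)
    ((𝓡 6).prod 𝓘(ℝ, EuclideanSpace ℝ (Fin 6) →L[ℝ] EuclideanSpace ℝ (Fin 6))) ∞
    (fun x => TotalSpace.mk' (EuclideanSpace ℝ (Fin 6) →L[ℝ] EuclideanSpace ℝ (Fin 6))
      (E := fun x : M => TangentSpace (𝓡 6) x →L[ℝ] TangentSpace (𝓡 6) x) x (toFun x))

namespace AlmostComplexStructure

variable {M : Type u} [TopologicalSpace M]
    [ChartedSpace (EuclideanSpace ℝ (Fin 6)) M] [IsManifold (𝓡 6) ∞ M]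

/-- The tangent space at `x`, regarded as a complex vector space in which `i` acts as `J`. -/
def CTangent (_J : AlmostComplexStructure M) (x : M) : Type := TangentSpace (𝓡 6) x

instance (J : AlmostComplexStructure M) (x : M) : AddCommGroup (J.CTangent x) :=
  inferInstanceAs (AddCommGroup (TangentSpace (𝓡 6) x))

/-- The tautological identification of the complex tangent space with the tangent space. -/
def toReal (J : AlmostComplexStructure M) (x : M) : J.CTangent x ≃+ TangentSpace (𝓡 6) x :=
  AddEquiv.refl (TangentSpace (𝓡 6) x)

instance (J : AlmostComplexStructure M) (x : M) : SMul ℂ (J.CTangent x) where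
  smul z v := (J.toReal x).symm (z.re • J.toReal x v + z.im • J.toFun x (J.toReal x v))

theorem toReal_smul (J : AlmostComplexStructure M) (x : M) (z : ℂ) (v : J.CTangent x) :
    J.toReal x (z • v) = z.re • J.toReal x v + z.im • J.toFun x (J.toReal x v) := rfl

instance (J : AlmostComplexStructure M) (x : M) : Module ℂ (J.CTangent x) where
  one_smul v := (J.toReal x).injective (by simp [toReal_smul])
  mul_smul z w v := (J.toReal x).injective (by
    simp only [toReal_smul, Complex.mul_re, Complex.mul_im, map_add, map_smul, J.sq]
    module)
  smul_zero z := (J.toReal x).injective (by simp [toReal_smul])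
  smul_add z v w := (J.toReal x).injective (by
    simp only [toReal_smul, map_add]; module)
  add_smul z w v := (J.toReal x).injective (by
    simp only [toReal_smul, map_add, Complex.add_re, Complex.add_im]; module)
  zero_smul v := (J.toReal x).injective (by simp [toReal_smul])

/-- A continuous local frame of the complex vector bundle `(TM, J)` over an open set `V`. -/
def IsContinuousFrame (J : AlmostComplexStructure M) {V : Opens M}
    (b : ∀ x : V, Module.Basis (Fin 3) ℂ (J.CTangent x)) : Prop :=
  ∀ i, Continuous fun x : V => (⟨x, J.toReal x (b x i)⟩ : TangentBundle (𝓡 6) M)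

theorem exists_basis (J : AlmostComplexStructure M) (x : M) :
    Nonempty (Module.Basis (Fin 3) ℂ (J.CTangent x)) := by
  let e : J.CTangent x ≃ₗ[ℝ] TangentSpace (𝓡 6) x :=
    { (J.toReal x) with
      map_smul' := fun r v => by
        change J.toReal x ((r : ℂ) • v) = r • J.toReal x v
        rw [toReal_smul, Complex.ofReal_re, Complex.ofReal_im, zero_smul, add_zero] }
  have : Module.Finite ℝ (TangentSpace (𝓡 6) x) :=
    inferInstanceAs (Module.Finite ℝ (EuclideanSpace ℝ (Fin 6)))
  have h6 : Module.finrank ℝ (TangentSpace (𝓡 6) x) = 6 := 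
    (finrank_euclideanSpace_fin : Module.finrank ℝ (EuclideanSpace ℝ (Fin 6)) = 6)
  have : Module.Finite ℝ (J.CTangent x) := Module.Finite.equiv e.symm
  have : Module.Finite ℂ (J.CTangent x) := Module.Finite.of_restrictScalars_finite ℝ ℂ _
  have h := finrank_real_of_complex (J.CTangent x)
  rw [e.finrank_eq, h6] at h
  exact ⟨Module.finBasisOfFinrankEq ℂ _ (by omega)⟩

/-- The real-linear map `c ↦ ∑ i, (re (c i) • a i + im (c i) • c' i)`, used to prove that coordinates with
respect to a continuous frame are continuous. -/
def frameMap (a c : Fin 3 → EuclideanSpace ℝ (Fin 6)) :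
    (Fin 3 → ℂ) →L[ℝ] EuclideanSpace ℝ (Fin 6) :=
  ∑ i, ((Complex.reCLM.comp (ContinuousLinearMap.proj i)).smulRight (a i) +
    (Complex.imCLM.comp (ContinuousLinearMap.proj i)).smulRight (c i))


theorem continuous_frameMap : Continuous fun p : (Fin 3 → EuclideanSpace ℝ (Fin 6)) ×
    (Fin 3 → EuclideanSpace ℝ (Fin 6)) => frameMap p.1 p.2 := by
  unfold frameMap
  refine continuous_finsetSum _ fun i _ => Continuous.add ?_ ?_
  · exact (ContinuousLinearMap.smulRightL ℝ (Fin 3 → ℂ) (EuclideanSpace ℝ (Fin 6))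
      (Complex.reCLM.comp (ContinuousLinearMap.proj i))).continuous.comp
      ((continuous_apply i).comp continuous_fst)
  · exact (ContinuousLinearMap.smulRightL ℝ (Fin 3 → ℂ) (EuclideanSpace ℝ (Fin 6))
      (Complex.imCLM.comp (ContinuousLinearMap.proj i))).continuous.comp
      ((continuous_apply i).comp continuous_snd)

/-- `c ↦ ∑ i, c i • s i`, read in the trivialization of the tangent bundle around `x₀`. -/
def localMap (J : AlmostComplexStructure M) (x₀ x : M) (s : Fin 3 → J.CTangent x) :
    (Fin 3 → ℂ) →L[ℝ] EuclideanSpace ℝ (Fin 6) :=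
  frameMap
    (fun i => (trivializationAt (EuclideanSpace ℝ (Fin 6)) (TangentSpace (𝓡 6)) x₀
      ⟨x, J.toReal x (s i)⟩).2)
    (fun i => (trivializationAt (EuclideanSpace ℝ (Fin 6)) (TangentSpace (𝓡 6)) x₀
      ⟨x, J.toFun x (J.toReal x (s i))⟩).2)

theorem localMap_apply (J : AlmostComplexStructure M) (x₀ x : M) (s : Fin 3 → J.CTangent x)
    (hx : x ∈ (trivializationAt (EuclideanSpace ℝ (Fin 6))
      (TangentSpace (𝓡 6) : M → Type _) x₀).baseSet) (c : Fin 3 → ℂ) :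
    J.localMap x₀ x s c = (trivializationAt (EuclideanSpace ℝ (Fin 6))
      (TangentSpace (𝓡 6)) x₀).continuousLinearEquivAt ℝ x hx
        (J.toReal x (∑ i, c i • s i)) := by
  simp only [localMap, frameMap, map_sum, toReal_smul, map_add, map_smul, sum_apply]
  rfl

theorem continuousAt_localMap (J : AlmostComplexStructure M) {Y : Type*} [TopologicalSpace Y]
    (p : Y → M) (s : ∀ y, Fin 3 → J.CTangent (p y)) (y₀ : Y)
    (hs : ∀ i, ContinuousAt
      (fun y => (⟨p y, J.toReal (p y) (s y i)⟩ : TangentBundle (𝓡 6) M)) y₀) :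
    ContinuousAt (fun y => J.localMap (p y₀) (p y) (s y)) y₀ := by
  have hp : ContinuousAt p y₀ :=
    ((FiberBundle.continuousAt_totalSpace (EuclideanSpace ℝ (Fin 6)) _).1 (hs 0)).1
  have hJ : ∀ i, ContinuousAt (fun y => (⟨p y, J.toFun (p y) (J.toReal (p y) (s y i))⟩ :
      TangentBundle (𝓡 6) M)) y₀ := fun i =>
    ContinuousAt.clm_bundle_apply (ϕ := fun y => J.toFun (p y))
      (ContinuousAt.comp (f := p) J.smooth.continuous.continuousAt hp) (hs i)
  refine continuous_frameMap.continuousAt.comp (f := fun y => (_, _)) (ContinuousAt.prodMk ?_ ?_)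
  · exact continuousAt_pi.2 fun i =>
      ((FiberBundle.continuousAt_totalSpace (EuclideanSpace ℝ (Fin 6)) _).1 (hs i)).2
  · exact continuousAt_pi.2 fun i =>
      ((FiberBundle.continuousAt_totalSpace (EuclideanSpace ℝ (Fin 6)) _).1 (hJ i)).2

theorem localMap_bijective (J : AlmostComplexStructure M) (x₀ x : M)
    (b : Module.Basis (Fin 3) ℂ (J.CTangent x))
    (hx : x ∈ (trivializationAt (EuclideanSpace ℝ (Fin 6))
      (TangentSpace (𝓡 6) : M → Type _) x₀).baseSet) :
    Function.Bijective (J.localMap x₀ x b) := by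
  have h : ⇑(J.localMap x₀ x b) = ((trivializationAt (EuclideanSpace ℝ (Fin 6))
      (TangentSpace (𝓡 6)) x₀).continuousLinearEquivAt ℝ x hx) ∘ (J.toReal x) ∘
      b.equivFun.symm := by
    funext c
    rw [localMap_apply J x₀ x b hx, Function.comp_apply, Function.comp_apply,
      Module.Basis.equivFun_symm_apply]
  rw [h]
  exact (ContinuousLinearEquiv.bijective _).comp
    ((J.toReal x).bijective.comp b.equivFun.symm.bijective)

/-- `localMap` of a basis, as an isomorphism. -/
def localEquiv (J : AlmostComplexStructure M) (x₀ x : M)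
    (b : Module.Basis (Fin 3) ℂ (J.CTangent x))
    (hx : x ∈ (trivializationAt (EuclideanSpace ℝ (Fin 6))
      (TangentSpace (𝓡 6) : M → Type _) x₀).baseSet) :
    (Fin 3 → ℂ) ≃L[ℝ] EuclideanSpace ℝ (Fin 6) :=
  (LinearEquiv.ofBijective (J.localMap x₀ x b).toLinearMap
    (J.localMap_bijective x₀ x b hx)).toContinuousLinearEquiv

theorem coe_localEquiv (J : AlmostComplexStructure M) (x₀ x : M)
    (b : Module.Basis (Fin 3) ℂ (J.CTangent x))
    (hx : x ∈ (trivializationAt (EuclideanSpace ℝ (Fin 6))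
      (TangentSpace (𝓡 6) : M → Type _) x₀).baseSet) :
    ((J.localEquiv x₀ x b hx : (Fin 3 → ℂ) ≃L[ℝ] EuclideanSpace ℝ (Fin 6)) :
      (Fin 3 → ℂ) →L[ℝ] EuclideanSpace ℝ (Fin 6)) = J.localMap x₀ x b := rfl

/-- The determinant of the change between two continuous complex frames is continuous. -/
theorem continuous_det (J : AlmostComplexStructure M) {V : Opens M}
    {b b' : ∀ x : V, Module.Basis (Fin 3) ℂ (J.CTangent x)}
    (hb : J.IsContinuousFrame b) (hb' : J.IsContinuousFrame b') :
    Continuous fun x : V => (b x).det (b' x) := by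
  rw [continuous_iff_continuousAt]
  intro y₀
  set t := trivializationAt (EuclideanSpace ℝ (Fin 6)) (TangentSpace (𝓡 6) : M → Type _) (y₀ : M)
  have hΦ := J.continuousAt_localMap (fun y : V => (y : M)) (fun y => b y) y₀
    fun i => (hb i).continuousAt
  have hinv : ContinuousAt (fun y : V => (J.localMap y₀ y (b y)).inverse) y₀ := by
    have h0 := FiberBundle.mem_baseSet_trivializationAt' (F := EuclideanSpace ℝ (Fin 6))
      (E := (TangentSpace (𝓡 6) : M → Type _)) (y₀ : M)
    have := (contDiffAt_map_inverse (𝕜 := ℝ) (n := 0)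
      (J.localEquiv y₀ y₀ (b y₀) h0)).continuousAt
    rw [coe_localEquiv] at this
    exact ContinuousAt.comp (f := fun y : V => J.localMap y₀ y (b y)) this hΦ
  have hbase : ∀ᶠ y : V in nhds y₀, (y : M) ∈ t.baseSet :=
    continuous_subtype_val.continuousAt.eventually
      (t.open_baseSet.mem_nhds (FiberBundle.mem_baseSet_trivializationAt' (y₀ : M)))
  have hrepr : ∀ j, ContinuousAt (fun y : V => (b y).equivFun (b' y j)) y₀ := by
    intro j
    have h1 : ContinuousAt (fun y : V => (t ⟨y, J.toReal y (b' y j)⟩).2) y₀ :=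
      ((FiberBundle.continuousAt_totalSpace (EuclideanSpace ℝ (Fin 6)) _).1
        (hb' j).continuousAt).2
    refine (hinv.clm_apply h1).congr ?_
    filter_upwards [hbase] with y hy
    have h2 : (t ⟨y, J.toReal y (b' y j)⟩).2 =
        J.localEquiv y₀ y (b y) hy ((b y).equivFun (b' y j)) := by
      change _ = J.localMap y₀ y (b y) ((b y).equivFun (b' y j))
      rw [localMap_apply J y₀ y (b y) hy, Module.Basis.sum_equivFun]
      rfl
    rw [← coe_localEquiv J y₀ y (b y) hy, ContinuousLinearMap.inverse_equiv, h2]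
    simp
  have hm : ContinuousAt (fun y : V => (b y).toMatrix (b' y)) y₀ := by
    refine continuousAt_pi.2 fun i => continuousAt_pi.2 fun j => ?_
    exact (continuous_apply i).continuousAt.comp (hrepr j)
  simp only [Module.Basis.det_apply]
  exact (Continuous.matrix_det continuous_id).continuousAt.comp hm

/-- The complex vector bundle `(TM, J)` has continuous local frames. -/
theorem exists_continuousFrame (J : AlmostComplexStructure M) (x₀ : M) :
    ∃ (V : Opens M) (b : ∀ x : V, Module.Basis (Fin 3) ℂ (J.CTangent x)),
      x₀ ∈ V ∧ J.IsContinuousFrame b := by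
  obtain ⟨b₀⟩ := J.exists_basis x₀
  set t := trivializationAt (EuclideanSpace ℝ (Fin 6)) (TangentSpace (𝓡 6) : M → Type _) x₀
    with ht
  have h0 : x₀ ∈ t.baseSet := FiberBundle.mem_baseSet_trivializationAt' x₀
  let s : ∀ x : M, Fin 3 → J.CTangent x := fun x i =>
    (J.toReal x).symm (t.symm x (t ⟨x₀, J.toReal x₀ (b₀ i)⟩).2)
  have hs₀ : s x₀ = b₀ := by
    funext i
    exact (J.toReal x₀).injective (t.symm_apply_apply_mk h0 (J.toReal x₀ (b₀ i)))
  have hs : ∀ i, ContinuousOn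
      (fun x => (⟨x, J.toReal x (s x i)⟩ : TangentBundle (𝓡 6) M)) t.baseSet := fun i =>
    t.continuousOn_symm.comp (f := fun x => (x, (t ⟨x₀, J.toReal x₀ (b₀ i)⟩).2))
      (by fun_prop) fun x hx => ⟨hx, trivial⟩
  have hΦ := J.continuousAt_localMap (fun x : M => x) s x₀
    fun i => (hs i).continuousAt (t.open_baseSet.mem_nhds h0)
  have hev : ∀ᶠ x in nhds x₀, Function.Bijective (J.localMap x₀ x (s x)) := by
    have h1 := ContinuousLinearEquiv.nhds (J.localEquiv x₀ x₀ b₀ h0)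
    rw [coe_localEquiv, ← hs₀] at h1
    filter_upwards [hΦ.eventually h1] with x hx
    obtain ⟨e, he⟩ := hx
    rw [← he]
    exact e.bijective
  obtain ⟨W, hW, hWo, hxW⟩ := eventually_nhds_iff.1
    (hev.and (t.open_baseSet.eventually_mem h0))
  have hbij : ∀ x : (⟨W, hWo⟩ : Opens M), Function.Bijective
      (Fintype.linearCombination ℂ (s x) : (Fin 3 → ℂ) →ₗ[ℂ] J.CTangent x) := by
    intro x
    have h1 := (hW x x.2).1
    have h2 : ⇑(J.localMap x₀ x (s x)) =
        (t.continuousLinearEquivAt ℝ (x : M) (hW x x.2).2 ∘ J.toReal x) ∘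
          (Fintype.linearCombination ℂ (s x)) := by
      funext c
      rw [localMap_apply J x₀ x (s x) (hW x x.2).2, Function.comp_apply,
        Fintype.linearCombination_apply]
      rfl
    rw [h2] at h1
    exact (Function.Bijective.of_comp_iff' ((ContinuousLinearEquiv.bijective _).comp
      (J.toReal (x : M)).bijective) _).1 h1
  refine ⟨⟨W, hWo⟩, fun x => Module.Basis.ofEquivFun
    (LinearEquiv.ofBijective _ (hbij x)).symm, hxW, fun i => ?_⟩
  have h3 : ∀ x : (⟨W, hWo⟩ : Opens M), Module.Basis.ofEquivFun
      (LinearEquiv.ofBijective _ (hbij x)).symm i = s x i := by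
    intro x
    simp [Fintype.linearCombination_apply]
  simp only [h3]
  exact ((hs i).mono fun x hx => (hW x hx).2).domRestrict

/-- Pairs `(n, F)` of an integer `n` and a function `F` from the complex bases of `(T_x M, J)` to `ℂˣ`.
Such a pair with `F b = F b' * (det_b b') ^ n` for all bases `b, b'` is a nonzero element `s` of the
complex line `(det_ℂ T_x M)^{⊗ n}`, namely `s = F b • (b 0 ∧ b 1 ∧ b 2)^{⊗ n}` for every basis `b`.
The group law is the tensor product of such elements (degrees add, the functions multiply). -/
def detFiber (J : AlmostComplexStructure M) (x : TopCat.of M) : Type :=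
  ℤ × (Module.Basis (Fin 3) ℂ (J.CTangent x) → Additive ℂˣ)

instance (J : AlmostComplexStructure M) (x : TopCat.of M) : AddCommGroup (J.detFiber x) :=
  inferInstanceAs (AddCommGroup (ℤ × (Module.Basis (Fin 3) ℂ (J.CTangent x) → Additive ℂˣ)))

/-- The family `f` is a pair of a locally constant function `n` and a continuous nowhere vanishing section
of `(det_ℂ TM)^{⊗ n}`: the coefficients with respect to continuous frames are continuous. -/
structure IsDetSection (J : AlmostComplexStructure M) {U : Opens (TopCat.of M)}
    (f : ∀ x : U, J.detFiber x) : Prop where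
  degree : Continuous fun x : U => (f x).1
  homogeneous : ∀ (x : U) (b b' : Module.Basis (Fin 3) ℂ (J.CTangent x)),
    (((f x).2 b).toMul : ℂ) = ((f x).2 b').toMul * (b.det b') ^ (f x).1
  continuous : ∀ (V : Opens M) (hV : V ≤ U)
    (b : ∀ x : V, Module.Basis (Fin 3) ℂ (J.CTangent x)), J.IsContinuousFrame b →
      Continuous fun x : V => (((f ⟨x, hV x.2⟩).2 (b x)).toMul : ℂ)

/-- The sheaf of pairs (locally constant `n`, nowhere vanishing section of `(det_ℂ TM)^{⊗ n}`). -/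
def detPred (J : AlmostComplexStructure M) : AddLocalPredicate (TopCat.of M) J.detFiber where
  pred := J.IsDetSection
  res {U V} i f hf :=
    { degree := hf.degree.comp (Continuous.subtype_mk continuous_subtype_val _)
      homogeneous := fun x => hf.homogeneous ⟨x, i.le x.2⟩
      continuous := fun W hW => hf.continuous W (hW.trans i.le) }
  locality {U} f h :=
    { degree := by
        refine continuous_iff_continuousAt.2 fun x => ?_
        obtain ⟨V, hxV, i, hV⟩ := h x
        have hop : Topology.IsOpenEmbedding (Set.inclusion i.le) := 
          TopologicalSpace.Opens.isOpenEmbedding_of_le i.le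
        exact (hop.continuousAt_iff (x := ⟨x, hxV⟩)).1 hV.degree.continuousAt
      homogeneous := fun x => by
        obtain ⟨V, hxV, i, hV⟩ := h x
        exact hV.homogeneous ⟨x, hxV⟩
      continuous := fun W hW b hb => by
        refine continuous_iff_continuousAt.2 fun x => ?_
        obtain ⟨V, hxV, i, hV⟩ := h ⟨x, hW x.2⟩
        have hop : Topology.IsOpenEmbedding (Set.inclusion (inf_le_right : V ⊓ W ≤ W)) :=
          TopologicalSpace.Opens.isOpenEmbedding_of_le (inf_le_right : V ⊓ W ≤ W)
        refine (hop.continuousAt_iff (x := ⟨x, hxV, x.2⟩)).1 ?_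
        exact (hV.continuous (V ⊓ W) inf_le_left (fun y => b ⟨y, y.2.2⟩)
          fun j => (hb j).comp hop.continuous).continuousAt }
  zero_mem U :=
    { degree := continuous_const
      homogeneous := fun x b b' => by
        change (1 : ℂ) = 1 * _ ^ (0 : ℤ)
        simp
      continuous := fun V hV b hb => continuous_const }
  add_mem {U f g} hf hg :=
    { degree := hf.degree.add hg.degree
      homogeneous := fun x b b' => by
        change (((f x).2 b).toMul : ℂ) * (((g x).2 b).toMul : ℂ) =
          (((f x).2 b').toMul * ((g x).2 b').toMul) * _ ^ ((f x).1 + (g x).1)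
        rw [hf.homogeneous x b b', hg.homogeneous x b b', zpow_add₀ (b.isUnit_det b').ne_zero]
        ring
      continuous := fun V hV b hb => (hf.continuous V hV b hb).mul (hg.continuous V hV b hb) }
  neg_mem {U f} hf :=
    { degree := hf.degree.neg
      homogeneous := fun x b b' => by
        change ((((f x).2 b).toMul⁻¹ : ℂˣ) : ℂ) =
          ((((f x).2 b').toMul⁻¹ : ℂˣ) : ℂ) * _ ^ (-(f x).1)
        rw [Units.val_inv_eq_inv_val, Units.val_inv_eq_inv_val, hf.homogeneous x b b', zpow_neg,
          mul_inv]
      continuous := fun V hV b hb => by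
        have h := (hf.continuous V hV b hb).inv₀ fun _ => Units.ne_zero _
        refine h.congr fun y => ?_
        exact (Units.val_inv_eq_inv_val _).symm }

/-- The extension `0 → C(-, ℂˣ) → E → ℤ → 0`, where `E` is the sheaf of pairs of a locally constant `n` and
a nowhere vanishing continuous section of `(det_ℂ TM)^{⊗ n}`. The preimage of `1 ∈ ℤ` in `E` is the
`ℂˣ`-torsor of nowhere vanishing sections of the line bundle `det_ℂ TM`, so the image of `1` under
the connecting map `H⁰(M; ℤ) → H¹(M; C(-, ℂˣ))` is the class of this line bundle. -/
def detSequence (J : AlmostComplexStructure M) :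
    ShortComplex (AbSheaf (TopCat.of M)) :=
  AddLocalPredicate.shortComplex (continuousPred (TopCat.of M) (Additive ℂˣ)) J.detPred
    (continuousPred (TopCat.of M) ℤ)
    (fun x => (AddMonoidHom.prod 0 (Pi.constAddMonoidHom _ _) :
      Additive ℂˣ →+ ℤ × (Module.Basis (Fin 3) ℂ (J.CTangent x) → Additive ℂˣ)))
    (fun x => (AddMonoidHom.fst _ _ :
      ℤ × (Module.Basis (Fin 3) ℂ (J.CTangent x) → Additive ℂˣ) →+ ℤ))
    (fun U f hf =>
      { degree := continuous_const
        homogeneous := fun x b b' => by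
          change ((f x).toMul : ℂ) = (f x).toMul * _ ^ (0 : ℤ)
          simp
        continuous := fun V hV b hb => 
          ((continuous_toUnits_iff f).1 hf).comp
            (Continuous.subtype_mk continuous_subtype_val fun y : V => hV y.2) })
    (fun _ _ hf => hf.degree)
    (fun _ _ => rfl)

theorem detSequence_shortExact (J : AlmostComplexStructure M) : J.detSequence.ShortExact := by
  apply AddLocalPredicate.shortComplex_shortExact
  · intro x u v h
    obtain ⟨b⟩ := J.exists_basis x
    exact congrFun (congrArg Prod.snd h) b
  · intro U f hf h
    have h1 : ∀ (x : U) (b b' : Module.Basis (Fin 3) ℂ (J.CTangent x)),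
        (f x).2 b = (f x).2 b' := by
      intro x b b'
      apply Additive.toMul.injective
      ext
      have h2 := hf.homogeneous x b b'
      rw [show (f x).1 = 0 from h x, zpow_zero, mul_one] at h2
      exact h2
    refine ⟨fun x => (f x).2 (J.exists_basis x).some, ?_, ?_⟩
    · refine (continuous_toUnits_iff _).2 (continuous_iff_continuousAt.2 fun x => ?_)
      obtain ⟨V, b, hxV, hb⟩ := J.exists_continuousFrame x
      have hop : Topology.IsOpenEmbedding (Set.inclusion (inf_le_right : V ⊓ U ≤ U)) :=
        TopologicalSpace.Opens.isOpenEmbedding_of_le (inf_le_right : V ⊓ U ≤ U)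
      have hop' : Topology.IsOpenEmbedding (Set.inclusion (inf_le_left : V ⊓ U ≤ V)) :=
        TopologicalSpace.Opens.isOpenEmbedding_of_le (inf_le_left : V ⊓ U ≤ V)
      refine (hop.continuousAt_iff (x := ⟨x, hxV, x.2⟩)).1 ?_
      refine ((hf.continuous (V ⊓ U) inf_le_right (fun y => b ⟨y, y.2.1⟩)
          fun j => (hb j).comp hop'.continuous).congr fun y => ?_).continuousAt
      exact congrArg (fun u : Additive ℂˣ => (u.toMul : ℂ)) (h1 ⟨y, y.2.2⟩ _ _)
    · intro x
      refine Prod.ext (h x).symm (funext fun b => h1 x _ _)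
  · intro U n hn x
    obtain ⟨V, b, hxV, hb⟩ := J.exists_continuousFrame x
    refine ⟨V ⊓ U, homOfLE inf_le_right, fun y => (n ⟨y, y.2.2⟩, fun b' =>
      Additive.ofMul ((((b ⟨y, y.2.1⟩).isUnit_det b').unit ^ n ⟨y, y.2.2⟩)⁻¹)),
      ⟨hxV, x.2⟩, ?_, fun _ => rfl⟩
    have hn' : Continuous n := hn
    refine ⟨hn'.comp (Continuous.subtype_mk continuous_subtype_val _), ?_, ?_⟩
    · intro y b₁ b₂
      set b₀ := b ⟨y, y.2.1⟩
      change (((((b₀.isUnit_det b₁).unit ^ n ⟨y, y.2.2⟩)⁻¹ : ℂˣ)) : ℂ) =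
        ((((b₀.isUnit_det b₂).unit ^ n ⟨y, y.2.2⟩)⁻¹ : ℂˣ) : ℂ) * (b₁.det b₂) ^ n ⟨y, y.2.2⟩
      have h1 : b₀.det b₂ = b₀.det b₁ * b₁.det b₂ := by
        rw [Module.Basis.det_apply, Module.Basis.det_apply, Module.Basis.det_apply,
          ← Matrix.det_mul, Module.Basis.toMatrix_mul_toMatrix]
      have h2 : b₁.det b₂ ≠ 0 := (b₁.isUnit_det b₂).ne_zero
      rw [Units.val_inv_eq_inv_val, Units.val_inv_eq_inv_val, Units.val_zpow_eq_zpow_val,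
        Units.val_zpow_eq_zpow_val, IsUnit.unit_spec, IsUnit.unit_spec, h1, mul_zpow, mul_inv,
        inv_mul_cancel_right₀ (zpow_ne_zero _ h2)]
    · intro W hW b' hb'
      have hW' : W ≤ V := hW.trans inf_le_left
      have hdet := J.continuous_det (V := W) (b := fun y => b ⟨y, hW' y.2⟩)
        (fun j => (hb j).comp (Continuous.subtype_mk continuous_subtype_val fun y : W => hW' y.2))
        hb'
      have hnW : Continuous fun y : W => n ⟨y, (hW y.2).2⟩ :=
        hn'.comp (Continuous.subtype_mk continuous_subtype_val fun y : W => (hW y.2).2)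
      have h3 : Continuous fun y : W => (((b ⟨y, hW' y.2⟩).det (b' y)) ^ n ⟨y, (hW y.2).2⟩)⁻¹ := by
        refine continuous_iff_continuousAt.2 fun y₀ => ?_
        have h4 : ContinuousAt (fun y : W =>
            (((b ⟨y, hW' y.2⟩).det (b' y)) ^ n ⟨y₀, (hW y₀.2).2⟩)⁻¹) y₀ :=
          (hdet.continuousAt.zpow₀ _ (Or.inl (Module.Basis.isUnit_det _ _).ne_zero)).inv₀
            (zpow_ne_zero _ (Module.Basis.isUnit_det _ _).ne_zero)
        refine h4.congr ?_
        filter_upwards [hnW.continuousAt.eventually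
          ((isOpen_discrete {n ⟨y₀, (hW y₀.2).2⟩}).mem_nhds rfl)] with y hy
        rw [show n ⟨y, (hW y.2).2⟩ = n ⟨y₀, (hW y₀.2).2⟩ from hy]
      refine h3.congr fun y => ?_
      change _ = (((((b ⟨y, hW' y.2⟩).isUnit_det (b' y)).unit ^ n ⟨y, (hW y.2).2⟩)⁻¹ : ℂˣ) : ℂ)
      rw [Units.val_inv_eq_inv_val, Units.val_zpow_eq_zpow_val, IsUnit.unit_spec]

end AlmostComplexStructure

/-- The connecting homomorphism `Hⁿ(X; S₃) → Hⁿ⁺¹(X; S₁)` of a short exact sequence of sheaves. -/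
def connecting {X : TopCat.{u}} {S : ShortComplex (AbSheaf X)}
    (hS : S.ShortExact) (n : ℕ) (c : CategoryTheory.Sheaf.H S.X₃ n) :
    CategoryTheory.Sheaf.H S.X₁ (n + 1) :=
  c.comp hS.extClass rfl

/-- The cohomology group `Hⁿ(M; ℤ)`: sheaf cohomology with coefficients in the constant sheaf `ℤ`. -/
abbrev IntegralCohomology (M : Type u) [TopologicalSpace M] (n : ℕ) : Type u :=
  CategoryTheory.Sheaf.H (intSheaf (TopCat.of M)) n

/-- The unit `1 ∈ H⁰(M; ℤ)`. -/
def oneClass (M : Type u) [TopologicalSpace M] : IntegralCohomology M 0 :=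
  (CategoryTheory.Sheaf.H.equiv₀ (intSheaf (TopCat.of M))
    (Limits.isTerminalTop (α := Opens (TopCat.of M)))).symm ⟨fun _ => 1, continuous_const⟩

/-- The first Chern class `c₁(M, J) = c₁(det_ℂ (TM, J)) ∈ H²(M; ℤ)`: the image of the class of the line
bundle `det_ℂ (TM, J)` in `H¹(M; C(-, ℂˣ))` under the connecting map `H¹(M; C(-, ℂˣ)) → H²(M; ℤ)` of
the exponential sequence. -/
def AlmostComplexStructure.firstChernClass {M : Type u} [TopologicalSpace M]
    [ChartedSpace (EuclideanSpace ℝ (Fin 6)) M] [IsManifold (𝓡 6) ∞ M]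
    (J : AlmostComplexStructure M) : IntegralCohomology M 2 :=
  connecting (expSequence_shortExact (TopCat.of M)) 1
    (connecting J.detSequence_shortExact 0 (oneClass M))

section Geometry

variable (n : ℕ) (N : Type*) [TopologicalSpace N] [ChartedSpace (EuclideanSpace ℝ (Fin n)) N]
  [IsManifold (𝓡 n) ∞ N]

/-- A pseudo-Riemannian metric: a smooth symmetric nondegenerate bilinear form on the tangent spaces. -/
structure PseudoRiemannianMetric where
  inner : ∀ y : N, TangentSpace (𝓡 n) y →L[ℝ] TangentSpace (𝓡 n) y →L[ℝ] ℝ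
  symm : ∀ (y : N) (v w : TangentSpace (𝓡 n) y), inner y v w = inner y w v
  nondegenerate : ∀ (y : N) (v : TangentSpace (𝓡 n) y), (∀ w, inner y v w = 0) → v = 0
  smooth : ContMDiff (𝓡 n)
    ((𝓡 n).prod 𝓘(ℝ, EuclideanSpace ℝ (Fin n) →L[ℝ] EuclideanSpace ℝ (Fin n) →L[ℝ] ℝ)) ∞
    (fun y => TotalSpace.mk' (EuclideanSpace ℝ (Fin n) →L[ℝ] EuclideanSpace ℝ (Fin n) →L[ℝ] ℝ)
      (E := fun y : N => TangentSpace (𝓡 n) y →L[ℝ] TangentSpace (𝓡 n) y →L[ℝ] ℝ) y (inner y))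

variable {n N}

/-- A smooth `r`-fold vector cross product on a pseudo-Riemannian manifold. Smoothness of the tensor
field means that it maps smooth local vector fields to smooth local vector fields. -/
structure VectorCrossProduct (g : PseudoRiemannianMetric n N) (r : ℕ) where
  toFun : ∀ y : N, MultilinearMap ℝ (fun _ : Fin r => TangentSpace (𝓡 n) y) (TangentSpace (𝓡 n) y)
  orthogonal : ∀ (y : N) (w : Fin r → TangentSpace (𝓡 n) y) (i : Fin r),
    g.inner y (toFun y w) (w i) = 0
  norm_sq : ∀ (y : N) (w : Fin r → TangentSpace (𝓡 n) y),
    g.inner y (toFun y w) (toFun y w) = (Matrix.of fun i j => g.inner y (w i) (w j)).det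
  smooth : ∀ (U : Opens N) (Y : Fin r → ∀ y : N, TangentSpace (𝓡 n) y),
    (∀ i, ContMDiffOn (𝓡 n) (𝓡 n).tangent ∞
      (fun y => (⟨y, Y i y⟩ : TangentBundle (𝓡 n) N)) U) →
    ContMDiffOn (𝓡 n) (𝓡 n).tangent ∞
      (fun y => (⟨y, toFun y fun i => Y i y⟩ : TangentBundle (𝓡 n) N)) U

variable (n N) in
/-- An orientation of a manifold: a choice of orientation of every tangent space such that around
every point there is a continuous positively oriented local frame. -/
structure TangentOrientation where
  orient : ∀ y : N, Orientation ℝ (TangentSpace (𝓡 n) y) (Fin n)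
  continuous : ∀ y₀ : N, ∃ (U : Opens N)
    (b : ∀ y : U, Module.Basis (Fin n) ℝ (TangentSpace (𝓡 n) (y : N))), y₀ ∈ U ∧
      (∀ i, Continuous fun y : U => (⟨y, b y i⟩ : TangentBundle (𝓡 n) N)) ∧
      ∀ y : U, (b y).orientation = orient y

/-- An immersion of a 6-manifold: a smooth map whose differential is injective at every point. -/
structure IsImmersion6 {M : Type*} [TopologicalSpace M]
    [ChartedSpace (EuclideanSpace ℝ (Fin 6)) M] [IsManifold (𝓡 6) ∞ M] (f : M → N) : Prop where
  smooth : ContMDiff (𝓡 6) (𝓡 n) ∞ f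
  injective : ∀ x : M, Function.Injective (mfderiv (𝓡 6) (𝓡 n) f x)

variable {M : Type*} [TopologicalSpace M] [ChartedSpace (EuclideanSpace ℝ (Fin 6)) M]
  [IsManifold (𝓡 6) ∞ M]

/-- The fibre `ν_x` of the normal bundle of `f : M → N`: the orthogonal complement of `df(T_x M)` in
`T_{f x} N`. -/
def normalSpace (g : PseudoRiemannianMetric n N) (f : M → N) (x : M) :
    Submodule ℝ (TangentSpace (𝓡 n) (f x)) where
  carrier := {w | ∀ v : TangentSpace (𝓡 6) x, g.inner (f x) w (mfderiv (𝓡 6) (𝓡 n) f x v) = 0}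
  zero_mem' v := by simp
  add_mem' hw hw' v := by simp [hw v, hw' v]
  smul_mem' c w hw v := by simp [hw v]

/-- The metric is positive definite on the normal space at `x`. -/
def NormalPosDef (g : PseudoRiemannianMetric n N) (f : M → N) (x : M) : Prop :=
  ∀ w ∈ normalSpace g f x, w ≠ 0 → 0 < g.inner (f x) w w

/-- The metric is negative definite on the normal space at `x`. -/
def NormalNegDef (g : PseudoRiemannianMetric n N) (f : M → N) (x : M) : Prop :=
  ∀ w ∈ normalSpace g f x, w ≠ 0 → g.inner (f x) w w < 0

/-- The normal bundle contains a trivial line bundle: there is an injective homomorphism of smooth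
vector bundles over `M` from `M × ℝ` to the normal bundle. -/
def NormalContainsTrivialLine (g : PseudoRiemannianMetric n N) (f : M → N) : Prop :=
  ∃ φ : ∀ x : M, ℝ →ₗ[ℝ] TangentSpace (𝓡 n) (f x),
    (∀ x, Function.Injective (φ x)) ∧ (∀ x t, φ x t ∈ normalSpace g f x) ∧
    ContMDiff ((𝓡 6).prod 𝓘(ℝ)) (𝓡 n).tangent ∞
      (fun p : M × ℝ => (⟨f p.1, φ p.1 p.2⟩ : TangentBundle (𝓡 n) N))

end Geometry

section Gray

variable {k : ℕ} {N : Type*} [TopologicalSpace N]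
  [ChartedSpace (EuclideanSpace ℝ (Fin (k + 6))) N] [IsManifold (𝓡 (k + 6)) ∞ N]
  {M : Type*} [TopologicalSpace M] [ChartedSpace (EuclideanSpace ℝ (Fin 6)) M]
  [IsManifold (𝓡 6) ∞ M]

/-- `a` is an oriented orthonormal frame of the normal space at `x`. The normal space has the
orientation for which a positively oriented frame of it, followed by the image of a positively
oriented frame of `T_x M`, is a positively oriented frame of `T_{f x} N`. -/
structure IsOrientedNormalFrame (g : PseudoRiemannianMetric (k + 6) N)
    (oN : TangentOrientation (k + 6) N) (oM : TangentOrientation 6 M) (f : M → N) (x : M)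
    (a : Fin k → TangentSpace (𝓡 (k + 6)) (f x)) : Prop where
  normal : ∀ i, a i ∈ normalSpace g f x
  orthogonal : ∀ i j, i ≠ j → g.inner (f x) (a i) (a j) = 0
  unit : ∀ i, |g.inner (f x) (a i) (a i)| = 1
  oriented : ∃ (u : Module.Basis (Fin 6) ℝ (TangentSpace (𝓡 6) x))
    (w : Module.Basis (Fin (k + 6)) ℝ (TangentSpace (𝓡 (k + 6)) (f x))),
    u.orientation = oM.orient x ∧ w.orientation = oN.orient (f x) ∧
    ⇑w = Fin.append a fun i => mfderiv (𝓡 6) (𝓡 (k + 6)) f x (u i)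

/-- `J` is Gray's almost complex structure of the immersion `f`: `J v = -X(a₁, …, a_k, v)` for all
oriented orthonormal frames `a₁, …, a_k` of the normal space, where tangent vectors of `M` are
identified with their images under `df`. -/
def IsGrayStructure {g : PseudoRiemannianMetric (k + 6) N} (X : VectorCrossProduct g (k + 1))
    (oN : TangentOrientation (k + 6) N) (oM : TangentOrientation 6 M) (f : M → N)
    (J : AlmostComplexStructure M) : Prop :=
  ∀ (x : M) (a : Fin k → TangentSpace (𝓡 (k + 6)) (f x)),
    IsOrientedNormalFrame g oN oM f x a → ∀ v : TangentSpace (𝓡 6) x,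
      mfderiv (𝓡 6) (𝓡 (k + 6)) f x (J.toFun x v) =
        -X.toFun (f x) (Fin.snoc (α := fun _ => TangentSpace (𝓡 (k + 6)) (f x)) a
          (mfderiv (𝓡 6) (𝓡 (k + 6)) f x v))

end Gray

end GrayChern

end

/-! Write k = m + 1. Normalizing a generator of the trivial line subbundle of the definite bundle ν
gives a global smooth unit normal field e. Fixing e in the first m slots of X leaves a 2-fold
product Y on the orthogonal complement of these m vectors: Y = X for k = 1, where e does not enter,
and Y(u,v) = X(e,u,v) on the complement of e for k = 2. If g has sign ε on ν_x, then Y is a 2-fold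
vector cross product for the rescaled form B = ε^m g. The last vector a of an oriented normal frame
that starts with e (m times) satisfies B(a,a) = ε^(m+1), which is 1 because sign -1 is allowed only
for k = 2. In these terms J is -Y(a,·) on TM.

The axioms polarize to Y v (Y v u) = -B(v,v) u + B(v,u) v (`IsCrossProductOn.double`). For v = a
this is J² = -1. Polarized in v, it says that Y v and Y w anticommute up to metric terms, and
therefore the real 3-form φ(u,v,w) = g(Y(u,v),w) on TM satisfies φ(Ju,v,w) = φ(u,Jv,w)
(`IsCrossProductOn.middle`). Hence φ is the real part of the complex 3-form φ - iφ(J·,·,·)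
(`complexVolumeForm`), and φ is nonzero at every point by a dimension count
(`IsCrossProductOn.exists_ne_zero`).

The decisive point is that φ involves e but not a, so it is defined on all of M. The resulting
complex volume form trivializes det_ℂ (TM, J): it lifts 1 ∈ H⁰(M; ℤ) to the middle term of
`detSequence`, so the class of the line bundle, and with it c₁, is zero
(`firstChernClass_eq_zero_of_volumeForm`).

For existence, J is defined pointwise by the formula. It does not depend on the oriented frame,
since two such frames differ by a matrix in SO(k) (`IsAdapted.map_eq_map`), and it is smooth since
smooth oriented normal frames exist locally (`exists_local_orientedNormalFrame`). -/

noncomputable section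

namespace GrayChern

universe u

/-! ### Connecting maps and triviality of the determinant line bundle. -/

theorem connecting_zero_eq_zero {X : TopCat.{u}} {S : ShortComplex (AbSheaf X)}
    (hS : S.ShortExact) (n : ℕ) : connecting hS n 0 = 0 := by
  unfold connecting
  exact Abelian.Ext.zero_comp ..

/-- A global section that lifts to the middle sheaf is killed by the connecting map. -/
theorem connecting_equiv₀_symm_eq_zero {X : TopCat.{u}} {S : ShortComplex (AbSheaf X)}
    (hS : S.ShortExact) (s : S.X₂.obj.obj (op (⊤ : Opens X))) :
    connecting hS 0 ((CategoryTheory.Sheaf.H.equiv₀ S.X₃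
      (Limits.isTerminalTop (α := Opens X))).symm (S.g.hom.app (op ⊤) s)) = 0 := by
  -- Naturality turns the class into one pushed forward along `S.g`, and `S.g` composed with the
  -- extension class is zero.
  rw [← CategoryTheory.Sheaf.H.equiv₀_symm_naturality, CategoryTheory.Sheaf.H.map_apply]
  unfold connecting
  rw [Abelian.Ext.comp_assoc_of_second_deg_zero, hS.comp_extClass, Abelian.Ext.comp_zero]

namespace AlmostComplexStructure

variable {M : Type u} [TopologicalSpace M]
    [ChartedSpace (EuclideanSpace ℝ (Fin 6)) M] [IsManifold (𝓡 6) ∞ M]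

/-- A continuous nowhere vanishing complex volume form trivializes `det_ℂ (TM, J)`. -/
theorem firstChernClass_eq_zero_of_volumeForm (J : AlmostComplexStructure M)
    (Ω : ∀ x : M, (J.CTangent x) [⋀^Fin 3]→ₗ[ℂ] ℂ)
    (hne : ∀ (x : M) (b : Module.Basis (Fin 3) ℂ (J.CTangent x)), Ω x b ≠ 0)
    (hcont : ∀ (V : Opens M) (b : ∀ x : V, Module.Basis (Fin 3) ℂ (J.CTangent x)),
      J.IsContinuousFrame b → Continuous fun x : V => Ω x (b x)) :
    J.firstChernClass = 0 := by
  -- The element Ω(b)⁻¹ • (b 0 ∧ b 1 ∧ b 2) does not depend on b: it is the section of det_ℂ TM on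
  -- which Ω takes the value 1. Hence the inverse.
  let s : ∀ x : (⊤ : Opens (TopCat.of M)), J.detFiber x := fun x =>
    (1, fun b => Additive.ofMul (Units.mk0 (Ω x b) (hne x b))⁻¹)
  have hs : J.IsDetSection s :=
    { degree := continuous_const
      homogeneous := fun x b b' => by
        change (((Units.mk0 (Ω x b) (hne x b))⁻¹ : ℂˣ) : ℂ) =
          (((Units.mk0 (Ω x b') (hne x b'))⁻¹ : ℂˣ) : ℂ) * (b.det b') ^ (1 : ℤ)
        have h1 : Ω x b' = Ω x b * b.det b' := by
          conv_lhs => rw [(Ω x).eq_smul_basis_det b]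
          rfl
        have h2 : b.det b' ≠ 0 := (b.isUnit_det b').ne_zero
        have h3 := hne x b
        rw [Units.val_inv_eq_inv_val, Units.val_inv_eq_inv_val, Units.val_mk0, Units.val_mk0, h1,
          zpow_one]
        field_simp
      continuous := fun V hV b hb => by
        have h1 : Continuous fun x : V => (Ω x (b x))⁻¹ :=
          (hcont V b hb).inv₀ fun x => hne x (b x)
        refine h1.congr fun x => ?_
        exact (Units.val_inv_eq_inv_val (Units.mk0 (Ω x (b x)) (hne x (b x)))).symm }
  have h0 : connecting J.detSequence_shortExact 0 (oneClass M) = 0 :=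
    connecting_equiv₀_symm_eq_zero J.detSequence_shortExact
      (⟨s, hs⟩ : J.detPred.sections ⊤)
  unfold firstChernClass
  exact (congrArg (connecting (expSequence_shortExact (TopCat.of M)) 1) h0).trans
    (connecting_zero_eq_zero _ _)

end AlmostComplexStructure

/-! ### Complex volume forms with prescribed real part. -/

/-- The complex alternating form whose real part is a real alternating form `φ` with
`φ (i u, v, w) = φ (u, i v, w)`. -/
def complexVolumeForm {V : Type*} [AddCommGroup V] [Module ℂ V] (φ : V → V → V → ℝ)
    (hadd : ∀ u u' v w, φ (u + u') v w = φ u v w + φ u' v w)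
    (hsmul : ∀ (r : ℝ) u v w, φ ((r : ℂ) • u) v w = r * φ u v w)
    (h12 : ∀ u v w, φ u v w = -φ v u w) (h23 : ∀ u v w, φ u v w = -φ u w v)
    (hI : ∀ u v w, φ (Complex.I • u) v w = φ u (Complex.I • v) w) : V [⋀^Fin 3]→ₗ[ℂ] ℂ :=
  -- The imaginary part is forced: F(iu) = i F(u) requires Im F(u) = -Re F(iu).
  let F : V → V → V → ℂ := fun u v w => φ u v w - Complex.I * φ (Complex.I • u) v w
  have F12 : ∀ u v w, F u v w = -F v u w := fun u v w => by
    simp only [F]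
    -- After the swap i sits in the second slot; `hI` brings it back to the first.
    rw [h12 u v w, h12 (Complex.I • u) v w, ← hI v u w]
    push_cast
    ring
  have F23 : ∀ u v w, F u v w = -F u w v := fun u v w => by
    simp only [F]
    rw [h23 u v w, h23 (Complex.I • u) v w]
    push_cast
    ring
  have Fadd : ∀ u u' v w, F (u + u') v w = F u v w + F u' v w := fun u u' v w => by
    simp only [F, smul_add, hadd]
    push_cast
    ring
  have Fsmul : ∀ (c : ℂ) u v w, F (c • u) v w = c * F u v w := fun c u v w => by
    have h1 : φ (c • u) v w = c.re * φ u v w + c.im * φ (Complex.I • u) v w := by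
      conv_lhs => rw [← Complex.re_add_im c, add_smul, hadd, mul_smul, hsmul, hsmul]
    have h2 : φ (Complex.I • c • u) v w = c.re * φ (Complex.I • u) v w - c.im * φ u v w := by
      have h3 : Complex.I • c • u = (c.re : ℂ) • Complex.I • u + ((-c.im : ℝ) : ℂ) • u := by
        rw [smul_smul, smul_smul, ← add_smul]
        congr 1
        conv_lhs => rw [← Complex.re_add_im c]
        push_cast
        linear_combination (c.im : ℂ) * Complex.I_mul_I
      rw [h3, hadd, hsmul, hsmul]
      ring
    simp only [F]
    rw [h1, h2]
    conv_rhs => rw [← Complex.re_add_im c]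
    push_cast
    linear_combination (c.im : ℂ) * φ (Complex.I • u) v w * Complex.I_mul_I
  -- With all transpositions available, linearity in the other two slots reduces to linearity in the
  -- first.
  have F13 : ∀ u v w, F u v w = -F w v u := fun u v w => by
    rw [F12, F23, F12, neg_neg]
  have diag12 : ∀ u w, F u u w = 0 := fun u w => self_eq_neg.1 (F12 u u w)
  have diag23 : ∀ u w, F u w w = 0 := fun u w => self_eq_neg.1 (F23 u w w)
  have diag13 : ∀ u w, F u w u = 0 := fun u w => self_eq_neg.1 (F13 u w u)
  have n01 : (0 : Fin 3) ≠ 1 := by decide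
  have n21 : (2 : Fin 3) ≠ 1 := by decide
  have n02 : (0 : Fin 3) ≠ 2 := by decide
  have n12 : (1 : Fin 3) ≠ 2 := by decide
  { toFun := fun m => F (m 0) (m 1) (m 2)
    map_update_add' := by
      intro inst m i x y
      have h : i = 0 ∨ i = 1 ∨ i = 2 := by omega
      rcases h with rfl | rfl | rfl
      · have h1 : ∀ z, Function.update m 0 z 1 = m 1 := fun z => Function.update_of_ne n01.symm z m
        have h2 : ∀ z, Function.update m 0 z 2 = m 2 := fun z => Function.update_of_ne n02.symm z m
        simp only [h1, h2, Function.update_self, Fadd]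
      · have h1 : ∀ z, Function.update m 1 z 0 = m 0 := fun z => Function.update_of_ne n01 z m
        have h2 : ∀ z, Function.update m 1 z 2 = m 2 := fun z => Function.update_of_ne n21 z m
        simp only [h1, h2, Function.update_self, F12 (m 0) _ (m 2), Fadd, neg_add]
      · have h1 : ∀ z, Function.update m 2 z 0 = m 0 := fun z => Function.update_of_ne n02 z m
        have h2 : ∀ z, Function.update m 2 z 1 = m 1 := fun z => Function.update_of_ne n12 z m
        simp only [h1, h2, Function.update_self, F13 (m 0) (m 1) _, Fadd, neg_add]
    map_update_smul' := by
      intro inst m i c x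
      have h : i = 0 ∨ i = 1 ∨ i = 2 := by omega
      rcases h with rfl | rfl | rfl
      · have h1 : ∀ z, Function.update m 0 z 1 = m 1 := fun z => Function.update_of_ne n01.symm z m
        have h2 : ∀ z, Function.update m 0 z 2 = m 2 := fun z => Function.update_of_ne n02.symm z m
        simp only [h1, h2, Function.update_self, Fsmul, smul_eq_mul]
      · have h1 : ∀ z, Function.update m 1 z 0 = m 0 := fun z => Function.update_of_ne n01 z m
        have h2 : ∀ z, Function.update m 1 z 2 = m 2 := fun z => Function.update_of_ne n21 z m
        simp only [h1, h2, Function.update_self, F12 (m 0) _ (m 2), Fsmul, smul_eq_mul, mul_neg]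
      · have h1 : ∀ z, Function.update m 2 z 0 = m 0 := fun z => Function.update_of_ne n02 z m
        have h2 : ∀ z, Function.update m 2 z 1 = m 1 := fun z => Function.update_of_ne n12 z m
        simp only [h1, h2, Function.update_self, F13 (m 0) (m 1) _, Fsmul, smul_eq_mul, mul_neg]
    map_eq_zero_of_eq' := fun m i j h hij => by
      have key : ∀ i j : Fin 3, i < j → m i = m j → F (m 0) (m 1) (m 2) = 0 := by
        intro i j hlt h
        have h' : i = 0 ∧ j = 1 ∨ i = 0 ∧ j = 2 ∨ i = 1 ∧ j = 2 := by omega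
        rcases h' with ⟨rfl, rfl⟩ | ⟨rfl, rfl⟩ | ⟨rfl, rfl⟩
        · rw [h, diag12]
        · rw [h, diag13]
        · rw [h, diag23]
      exact hij.lt_or_gt.elim (key i j · h) (key j i · h.symm) }

theorem complexVolumeForm_apply {V : Type*} [AddCommGroup V] [Module ℂ V] (φ : V → V → V → ℝ)
    (hadd hsmul h12 h23 hI) (m : Fin 3 → V) :
    complexVolumeForm φ hadd hsmul h12 h23 hI m =
      φ (m 0) (m 1) (m 2) - Complex.I * φ (Complex.I • m 0) (m 1) (m 2) := rfl

/-- An alternating 3-form in complex dimension 3 is its value on b times the determinant of b. If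
that value were zero, the whole form and its real part φ would vanish. -/
theorem complexVolumeForm_ne_zero {V : Type*} [AddCommGroup V] [Module ℂ V] (φ : V → V → V → ℝ)
    (hadd hsmul h12 h23 hI) (hne : ∃ u v w, φ u v w ≠ 0) (b : Module.Basis (Fin 3) ℂ V) :
    complexVolumeForm φ hadd hsmul h12 h23 hI b ≠ 0 := by
  intro h0
  obtain ⟨u, v, w, h⟩ := hne
  have h1 := (complexVolumeForm φ hadd hsmul h12 h23 hI).eq_smul_basis_det b
  rw [h0, zero_smul] at h1
  have h2 := congrArg (fun G => (G ![u, v, w]).re) h1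
  rw [complexVolumeForm_apply] at h2
  simp at h2
  exact h h2

/-! ### Algebra of 2-fold vector cross products. -/

/-- `Y` restricts to a 2-fold vector cross product on the subspace `P`, on which the symmetric
bilinear form `B` is nondegenerate. -/
structure IsCrossProductOn {V : Type*} [AddCommGroup V] [Module ℝ V] (B : V →ₗ[ℝ] V →ₗ[ℝ] ℝ)
    (P : Submodule ℝ V) (Y : V →ₗ[ℝ] V →ₗ[ℝ] V) : Prop where
  symm : ∀ u v, B u v = B v u
  nondegenerate : ∀ u ∈ P, (∀ w ∈ P, B u w = 0) → u = 0
  mem : ∀ u ∈ P, ∀ v ∈ P, Y u v ∈ P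
  orthogonal_left : ∀ u ∈ P, ∀ v ∈ P, B (Y u v) u = 0
  orthogonal_right : ∀ u ∈ P, ∀ v ∈ P, B (Y u v) v = 0
  norm_sq : ∀ u ∈ P, ∀ v ∈ P, B (Y u v) (Y u v) = B u u * B v v - B u v * B u v

namespace IsCrossProductOn

variable {V : Type*} [AddCommGroup V] [Module ℝ V] {B : V →ₗ[ℝ] V →ₗ[ℝ] ℝ}
  {P : Submodule ℝ V} {Y : V →ₗ[ℝ] V →ₗ[ℝ] V}

theorem eq_of_forall (h : IsCrossProductOn B P Y) {u v : V} (hu : u ∈ P) (hv : v ∈ P)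
    (huv : ∀ w ∈ P, B u w = B v w) : u = v :=
  sub_eq_zero.1 (h.nondegenerate _ (P.sub_mem hu hv) fun w hw => by simp [huv w hw])

theorem skew_left (h : IsCrossProductOn B P Y) {u v w : V} (hu : u ∈ P) (hv : v ∈ P)
    (hw : w ∈ P) : B (Y u v) w = -B (Y w v) u := by
  have h1 := h.orthogonal_left _ (P.add_mem hu hw) v hv
  simp only [map_add, LinearMap.add_apply, h.orthogonal_left u hu v hv,
    h.orthogonal_left w hw v hv] at h1
  linarith

theorem skew_right (h : IsCrossProductOn B P Y) {u v w : V} (hu : u ∈ P) (hv : v ∈ P)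
    (hw : w ∈ P) : B (Y u v) w = -B (Y u w) v := by
  have h1 := h.orthogonal_right u hu _ (P.add_mem hv hw)
  simp only [map_add, LinearMap.add_apply, h.orthogonal_right u hu v hv,
    h.orthogonal_right u hu w hw] at h1
  linarith

/-- The trilinear form B(Y u v, w) changes sign when w is exchanged with u or with v. Three such
exchanges transpose u and v, and nondegeneracy on P removes w. -/
theorem swap (h : IsCrossProductOn B P Y) {u v : V} (hu : u ∈ P) (hv : v ∈ P) :
    Y u v = -Y v u := by
  refine h.eq_of_forall (h.mem u hu v hv) (P.neg_mem (h.mem v hv u hu)) fun w hw => ?_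
  rw [h.skew_left hu hv hw, h.skew_right hw hv hu, h.skew_left hw hu hv]
  simp

theorem polar (h : IsCrossProductOn B P Y) {u v w : V} (hu : u ∈ P) (hv : v ∈ P)
    (hw : w ∈ P) : B (Y v u) (Y v w) = B v v * B u w - B v u * B v w := by
  have h1 := h.norm_sq v hv _ (P.add_mem hu hw)
  simp only [map_add, LinearMap.add_apply, h.norm_sq v hv u hu, h.norm_sq v hv w hw,
    h.symm (Y v w) (Y v u), h.symm w u] at h1
  linarith

/-- Pair with w: skewness moves the outer `Y v` onto w, and `polar` evaluates the inner product that
results. This is the source of J² = -1. -/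
theorem double (h : IsCrossProductOn B P Y) {u v : V} (hu : u ∈ P) (hv : v ∈ P) :
    Y v (Y v u) = -(B v v) • u + B v u • v := by
  refine h.eq_of_forall (h.mem _ hv _ (h.mem _ hv _ hu))
    (P.add_mem (P.smul_mem _ hu) (P.smul_mem _ hv)) fun w hw => ?_
  rw [h.skew_right hv (h.mem _ hv _ hu) hw, h.polar hw hv hu, h.symm w u]
  simp only [map_add, map_smul, LinearMap.add_apply, LinearMap.smul_apply, smul_eq_mul]
  ring

/-- Polarization of `double` in v: a Clifford-type anticommutation of `Y v` and `Y w` up to metric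
terms. -/
theorem double_polar (h : IsCrossProductOn B P Y) {u v w : V} (hu : u ∈ P) (hv : v ∈ P)
    (hw : w ∈ P) : Y v (Y w u) + Y w (Y v u) =
      -(2 * B v w) • u + B v u • w + B w u • v := by
  have h1 := h.double hu (P.add_mem hv hw)
  simp only [map_add, LinearMap.add_apply, h.double hu hv, h.double hu hw, h.symm w v] at h1
  have h2 : Y v (Y w u) + Y w (Y v u) = (-(B v v) • u + B v u • v + Y w (Y v u) +
      (Y v (Y w u) + (-(B w w) • u + B w u • w))) - (-(B v v) • u + B v u • v) -
      (-(B w w) • u + B w u • w) := by abel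
  rw [h2, h1]
  module

/-- For `J = Y a`, the form `B (Y u v) w` satisfies `φ (J u) v w = φ u (J v) w` on `a^⊥`. -/
theorem middle (h : IsCrossProductOn B P Y) {a u v w : V} (ha : a ∈ P) (hu : u ∈ P) (hv : v ∈ P)
    (hau : B a u = 0) (hav : B a v = 0) (haw : B a w = 0) :
    B (Y (Y a u) v) w = B (Y u (Y a v)) w := by
  -- By anticommutation both vectors equal -Y a (Y u v) up to a multiple of a, and w is orthogonal
  -- to a.
  have h1 := h.double_polar hu hv ha
  have h2 := h.double_polar hv hu ha
  rw [h.swap (h.mem a ha u hu) hv, eq_sub_of_add_eq h1, eq_sub_of_add_eq h2, h.swap hv hu]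
  simp [hau, hav, haw, h.symm v a, h.symm u a]

/-- If `a` is a unit vector, then the form `B (Y u v) w` does not vanish on `a^⊥`. -/
theorem exists_ne_zero (h : IsCrossProductOn B P Y) {a : V} (ha : a ∈ P) (haa : B a a = 1)
    {W : Submodule ℝ V} (hW : ∀ w, w ∈ W ↔ w ∈ P ∧ B a w = 0) (hfin : 3 ≤ Module.finrank ℝ W) :
    ∃ u ∈ W, ∃ v ∈ W, ∃ w ∈ W, B (Y u v) w ≠ 0 := by
  by_contra! h0
  have hWP : ∀ u ∈ W, u ∈ P := fun u hu => ((hW u).1 hu).1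
  -- If the form vanishes on W, every product of two vectors of W lies on the line of a.
  have hY : ∀ u ∈ W, ∀ v ∈ W, Y u v = B (Y u v) a • a := fun u hu v hv => by
    refine h.eq_of_forall (h.mem _ (hWP u hu) _ (hWP v hv)) (P.smul_mem _ ha) fun w hw => ?_
    have h1 : w - B a w • a ∈ W := (hW _).2 ⟨P.sub_mem hw (P.smul_mem _ ha), by simp [haa]⟩
    have h2 := h0 u hu v hv _ h1
    simp only [map_sub, map_smul, smul_eq_mul] at h2
    simp only [map_smul, LinearMap.smul_apply, smul_eq_mul]
    linarith
  -- Otherwise B would vanish on W by polarization; since W is orthogonal to the non-null vector a,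
  -- nondegeneracy on P would give W = 0.
  obtain ⟨u, hu, huu⟩ : ∃ u ∈ W, B u u ≠ 0 := by
    by_contra! h1
    have h2 : ∀ u ∈ W, ∀ v ∈ W, B u v = 0 := fun u hu v hv => by
      have h3 := h1 _ (W.add_mem hu hv)
      simp only [map_add, LinearMap.add_apply, h1 u hu, h1 v hv, h.symm v u] at h3
      linarith
    have h4 : W = ⊥ := by
      refine (Submodule.eq_bot_iff _).2 fun u hu => h.nondegenerate u (hWP u hu) fun w hw => ?_
      have h5 : w - B a w • a ∈ W := (hW _).2 ⟨P.sub_mem hw (P.smul_mem _ ha), by simp [haa]⟩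
      have h6 := h2 u hu _ h5
      simp only [map_sub, map_smul, smul_eq_mul, h.symm u a, ((hW u).1 hu).2] at h6
      linarith
    rw [h4, finrank_bot] at hfin
    omega
  -- Now Y u (Y u v) is a multiple of Y u a, and `double` can be solved for v because B u u ≠ 0.
  -- Thus dim W ≤ 2, a contradiction.
  have h7 : W ≤ Submodule.span ℝ {u, Y u a} := fun v hv => by
    have h8 := h.double (hWP v hv) (hWP u hu)
    have h9 : Y u (Y u v) = B (Y u v) a • Y u a := by
      conv_lhs => rw [hY u hu v hv]
      rw [map_smul]
    rw [h9] at h8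
    refine Submodule.mem_span_pair.2 ⟨B u v / B u u, -(B (Y u v) a / B u u), ?_⟩
    have h10 : v = (B u u)⁻¹ • (B u v • u - B (Y u v) a • Y u a) := by
      rw [h8]
      match_scalars
      · field_simp
      · ring
    conv_rhs => rw [h10]
    module
  have h11 : ({u, Y u a} : Set V).Finite := Set.toFinite _
  let _ : Fintype ({u, Y u a} : Set V) := h11.fintype
  have h12 : Module.Finite ℝ (Submodule.span ℝ ({u, Y u a} : Set V)) :=
    Module.Finite.span_of_finite ℝ h11
  have h13 := (Submodule.finrank_mono h7).trans (finrank_span_le_card ({u, Y u a} : Set V))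
  have h14 : ({u, Y u a} : Set V).toFinset.card ≤ 2 := by
    rw [← Set.ncard_eq_toFinset_card']
    exact (Set.ncard_insert_le _ _).trans (by simp)
  omega

end IsCrossProductOn

/-! ### Reduction of a vector cross product to a 2-fold one. -/

/-- A vector cross product on a vector space with a nondegenerate symmetric bilinear form. -/
structure IsVectorCross {V : Type*} [AddCommGroup V] [Module ℝ V] (g : V →ₗ[ℝ] V →ₗ[ℝ] ℝ)
    {r : ℕ} (X : MultilinearMap ℝ (fun _ : Fin r => V) V) : Prop where
  symm : ∀ u v, g u v = g v u
  nondegenerate : ∀ u, (∀ w, g u w = 0) → u = 0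
  orthogonal : ∀ w i, g (X w) (w i) = 0
  norm_sq : ∀ w, g (X w) (X w) = (Matrix.of fun i j => g (w i) (w j)).det

/-- The vectors that are orthogonal to all members of a family. -/
def perp {V : Type*} [AddCommGroup V] [Module ℝ V] (g : V →ₗ[ℝ] V →ₗ[ℝ] ℝ) {ι : Type*}
    (p : ι → V) : Submodule ℝ V where
  carrier := {w | ∀ i, g (p i) w = 0}
  zero_mem' i := map_zero _
  add_mem' hw hw' i := by rw [map_add, hw i, hw' i, add_zero]
  smul_mem' c w hw i := by rw [map_smul, hw i, smul_zero]

/-- The part of a vector that is orthogonal to an orthogonal family of non-null vectors. -/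
theorem sub_sum_mem_perp {V : Type*} [AddCommGroup V] [Module ℝ V] {g : V →ₗ[ℝ] V →ₗ[ℝ] ℝ}
    {ι : Type*} [Fintype ι] {p : ι → V} (hp : ∀ i j, i ≠ j → g (p i) (p j) = 0)
    (hp0 : ∀ i, g (p i) (p i) ≠ 0) (z : V) :
    z - ∑ i, (g (p i) z / g (p i) (p i)) • p i ∈ perp g p := by
  intro j
  rw [map_sub, map_sum, Finset.sum_eq_single j]
  · simp [hp0 j]
  · intro i _ hij
    simp [hp j i hij.symm]
  · simp

namespace IsVectorCross

variable {V : Type*} [AddCommGroup V] [Module ℝ V] {g : V →ₗ[ℝ] V →ₗ[ℝ] ℝ}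

/-- Polarizing the orthogonality in slot i gives ⟨X w, z⟩ = -⟨X w', w i⟩, where w' has z in slot i.
The right side is zero because w i = w j still occupies slot j of w'. -/
theorem map_eq_zero_of_eq {r : ℕ} {X : MultilinearMap ℝ (fun _ : Fin r => V) V}
    (h : IsVectorCross g X) (w : Fin r → V) {i j : Fin r} (hw : w i = w j) (hij : i ≠ j) :
    X w = 0 := by
  refine h.nondegenerate _ fun z => ?_
  have h1 := h.orthogonal (Function.update w i (w i + z)) i
  have h2 := h.orthogonal (Function.update w i (w i)) i
  have h3 := h.orthogonal (Function.update w i z) i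
  have h4 := h.orthogonal (Function.update w i z) j
  rw [X.map_update_add] at h1
  simp only [Function.update_self, map_add, LinearMap.add_apply] at h1 h2 h3
  rw [Function.update_of_ne hij.symm, ← hw] at h4
  rw [Function.update_eq_self] at h1
  rw [Function.update_eq_self] at h2
  linarith

/-- The product as a function of its first arguments, paired with a vector. -/
def curryPairing {k : ℕ} {X : MultilinearMap ℝ (fun _ : Fin (k + 1) => V) V}
    (h : IsVectorCross g X) (v z : V) : V [⋀^Fin k]→ₗ[ℝ] ℝ :=
  { ((g z).comp (LinearMap.applyₗ v)).compMultilinearMap X.curryRight with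
    map_eq_zero_of_eq' := fun a i j haij hij => by
      have h1 : X (Fin.snoc a v) = 0 :=
        h.map_eq_zero_of_eq _ (i := i.castSucc) (j := j.castSucc) (by simpa using haij)
          (fun e => hij (Fin.castSucc_injective _ e))
      change g z (X (Fin.snoc a v)) = 0
      rw [h1, map_zero] }

theorem curryPairing_apply {k : ℕ} {X : MultilinearMap ℝ (fun _ : Fin (k + 1) => V) V}
    (h : IsVectorCross g X) (v z : V) (a : Fin k → V) :
    h.curryPairing v z a = g z (X (Fin.snoc a v)) := rfl

end IsVectorCross

/-- The product as a bilinear function of its last two arguments. -/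
def lastPair {V : Type*} [AddCommGroup V] [Module ℝ V] {m : ℕ}
    (X : MultilinearMap ℝ (fun _ : Fin (m + 1 + 1) => V) V) (p : Fin m → V) : V →ₗ[ℝ] V →ₗ[ℝ] V :=
  MultilinearMap.curryRight (M := fun _ => V) (MultilinearMap.curryRight (M := fun _ => V) X) p

theorem lastPair_apply {V : Type*} [AddCommGroup V] [Module ℝ V] {m : ℕ}
    (X : MultilinearMap ℝ (fun _ : Fin (m + 1 + 1) => V) V) (p : Fin m → V) (u v : V) :
    lastPair X p u v =
      X (Fin.snoc (α := fun _ => V) (Fin.snoc (α := fun _ => V) p u) v) := rfl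

/-- The Gram matrix is block diagonal because u and v are orthogonal to p. Since p has at most one
member, the explicit determinants of size 2 and 3 suffice. -/
theorem det_gram_snoc_snoc {V : Type*} [AddCommGroup V] [Module ℝ V] {g : V →ₗ[ℝ] V →ₗ[ℝ] ℝ}
    (hsymm : ∀ u v, g u v = g v u) {m : ℕ} (hm : m = 0 ∨ m = 1) {p : Fin m → V} {ε : ℝ}
    (hp : ∀ i, g (p i) (p i) = ε) {u v : V} (hu : u ∈ perp g p) (hv : v ∈ perp g p) :
    (Matrix.of fun i j : Fin (m + 1 + 1) =>
      g (Fin.snoc (α := fun _ => V) (Fin.snoc (α := fun _ => V) p u) v i)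
        (Fin.snoc (α := fun _ => V) (Fin.snoc (α := fun _ => V) p u) v j)).det =
      ε ^ m * (g u u * g v v - g u v * g u v) := by
  rcases hm with rfl | rfl
  · rw [Matrix.det_fin_two]
    change g u u * g v v - g u v * g v u = _
    rw [hsymm v u]
    ring
  · rw [Matrix.det_fin_three]
    change g (p 0) (p 0) * g u u * g v v - g (p 0) (p 0) * g u v * g v u -
      g (p 0) u * g u (p 0) * g v v + g (p 0) u * g u v * g v (p 0) +
      g (p 0) v * g u (p 0) * g v u - g (p 0) v * g u u * g v (p 0) = _
    rw [hsymm v u, hu 0, hv 0, hp 0]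
    ring

/-- Fixing orthonormal vectors in the first arguments of a vector cross product leaves a 2-fold
vector cross product on their orthogonal complement. -/
theorem IsVectorCross.isCrossProductOn {V : Type*} [AddCommGroup V] [Module ℝ V]
    {g : V →ₗ[ℝ] V →ₗ[ℝ] ℝ} {m : ℕ} (hm : m = 0 ∨ m = 1)
    {X : MultilinearMap ℝ (fun _ : Fin (m + 1 + 1) => V) V} (h : IsVectorCross g X)
    {p : Fin m → V} {ε : ℝ} (hε : |ε| = 1) (hp : ∀ i, g (p i) (p i) = ε)
    (hpp : ∀ i j, i ≠ j → g (p i) (p j) = 0) :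
    IsCrossProductOn (ε ^ m • g) (perp g p) (lastPair X p) where
  symm u v := by simp [h.symm u v]
  nondegenerate u hu huw := by
    have hε0 : ε ≠ 0 := fun h0 => by simp [h0] at hε
    refine h.nondegenerate u fun z => ?_
    have h1 := huw _ (sub_sum_mem_perp hpp (fun i => by rw [hp i]; exact hε0) z)
    simp only [LinearMap.smul_apply, smul_eq_mul, mul_eq_zero, pow_ne_zero m hε0, false_or, map_sub,
      map_sum, map_smul, h.symm u (p _), hu _, mul_zero, Finset.sum_const_zero, sub_zero] at h1
    exact h1
  mem u _ v _ i := by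
    rw [h.symm, lastPair_apply]
    have h1 := h.orthogonal (Fin.snoc (α := fun _ => V) (Fin.snoc (α := fun _ => V) p u) v)
      i.castSucc.castSucc
    simpa using h1
  orthogonal_left u _ v _ := by
    have h1 := h.orthogonal (Fin.snoc (α := fun _ => V) (Fin.snoc (α := fun _ => V) p u) v)
      (Fin.last m).castSucc
    simp only [Fin.snoc_castSucc, Fin.snoc_last] at h1
    simp [lastPair_apply, h1]
  orthogonal_right u _ v _ := by
    have h1 := h.orthogonal (Fin.snoc (α := fun _ => V) (Fin.snoc (α := fun _ => V) p u) v)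
      (Fin.last (m + 1))
    simp only [Fin.snoc_last] at h1
    simp [lastPair_apply, h1]
  -- The reason for rescaling g by ε^m: the left side carries one ε^m from the form and one from the
  -- Gram determinant, which matches the right side, quadratic in the form.
  norm_sq u hu v hv := by
    simp only [LinearMap.smul_apply, smul_eq_mul, lastPair_apply, h.norm_sq]
    rw [det_gram_snoc_snoc h.symm hm hp hu hv]
    ring

/-! ### Adapted frames and independence of the oriented normal frame. -/

section Frames

variable {V T : Type*} [AddCommGroup V] [Module ℝ V] [AddCommGroup T] [Module ℝ T]
  {g : V →ₗ[ℝ] V →ₗ[ℝ] ℝ} {k d : ℕ}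

/-- A basis of the space that consists of a frame `a` of the normal space with
`⟨a i, a j⟩ = ε δ_ij` and the image of a basis of the tangent space. -/
structure IsAdapted (g : V →ₗ[ℝ] V →ₗ[ℝ] ℝ) (A : T →ₗ[ℝ] V) (ε : ℝ) (a : Fin k → V)
    (u : Module.Basis (Fin d) ℝ T) (w : Module.Basis (Fin (k + d)) ℝ V) : Prop where
  symm : ∀ u v, g u v = g v u
  nondegenerate : ∀ u, (∀ w, g u w = 0) → u = 0
  unit : |ε| = 1
  norm : ∀ i, g (a i) (a i) = ε
  orthogonal : ∀ i j, i ≠ j → g (a i) (a j) = 0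
  normal : ∀ i v, g (a i) (A v) = 0
  coe_eq : ⇑w = Fin.append a (A ∘ u)

namespace IsAdapted

variable {A : T →ₗ[ℝ] V} {ε : ℝ} {a a' : Fin k → V} {u u' : Module.Basis (Fin d) ℝ T}
  {w w' : Module.Basis (Fin (k + d)) ℝ V}

theorem ne_zero (h : IsAdapted g A ε a u w) : ε ≠ 0 := fun h0 => by simpa [h0] using h.unit

theorem mul_self (h : IsAdapted g A ε a u w) : ε * ε = 1 := by
  rw [← abs_mul_abs_self, h.unit, one_mul]

theorem exists_eq_add (h : IsAdapted g A ε a u w) (z : V) :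
    ∃ (c : Fin k → ℝ) (v : T), z = ∑ i, c i • a i + A v := by
  refine ⟨fun i => w.repr z (Fin.castAdd d i), ∑ j, w.repr z (Fin.natAdd k j) • u j, ?_⟩
  conv_lhs => rw [← w.sum_repr z, Fin.sum_univ_add]
  simp [h.coe_eq]

theorem exists_eq_of_mem_perp (h : IsAdapted g A ε a u w) {z : V} (hz : z ∈ perp g a) :
    ∃ v, z = A v := by
  obtain ⟨c, v, hv⟩ := h.exists_eq_add z
  refine ⟨v, ?_⟩
  have hc : ∀ j, c j = 0 := fun j => by
    have h1 := hz j
    rw [hv, map_add, map_sum, h.normal, Finset.sum_eq_single j] at h1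
    · simpa [h.norm, h.ne_zero] using h1
    · intro i _ hij
      simp [h.orthogonal j i hij.symm]
    · simp
  rw [hv]
  simp [hc]

theorem eq_zero_of_perp (h : IsAdapted g A ε a u w) {z : V} (hz : z ∈ perp g a)
    (hz' : ∀ v, g z (A v) = 0) : z = 0 := by
  refine h.nondegenerate z fun y => ?_
  obtain ⟨c, v, rfl⟩ := h.exists_eq_add y
  simp [hz', h.symm z (a _), hz _]

/-- Subtracting the projection to the span of a leaves a vector orthogonal to a and to the image of
A, hence zero. Division by ε is multiplication by ε since ε = ±1. -/
theorem eq_sum (h : IsAdapted g A ε a u w) {z : V} (hz : ∀ v, g z (A v) = 0) :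
    z = ∑ i, (ε * g (a i) z) • a i := by
  have h1 := sub_sum_mem_perp h.orthogonal (fun i => by rw [h.norm]; exact h.ne_zero) z
  have h2 := sub_eq_zero.1 (h.eq_zero_of_perp h1 fun v => by simp [hz, h.normal])
  conv_lhs => rw [h2]
  refine Finset.sum_congr rfl fun i _ => ?_
  rw [h.norm, div_eq_iff h.ne_zero |>.2]
  linear_combination -(g (a i) z) * h.mul_self

/-- Alternating forms take the same value on two adapted frames of the same orientation. -/
theorem map_eq_map (h : IsAdapted g A ε a u w) (h' : IsAdapted g A ε a' u' w')
    (hw : w.orientation = w'.orientation) (hu : u.orientation = u'.orientation)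
    (F : V [⋀^Fin k]→ₗ[ℝ] ℝ) : F a = F a' := by
  let R : Matrix (Fin k) (Fin k) ℝ := Matrix.of fun i j => ε * g (a i) (a' j)
  have hR : ∀ j, a' j = ∑ i, R i j • a i := fun j => h.eq_sum (h'.normal j)
  -- Both frames have Gram matrix ε times the identity, so the change of frame R is orthogonal for
  -- either sign of ε.
  have hRR : R.transpose * R = 1 := by
    ext j l
    have h1 : g (a' j) (a' l) = ε * ∑ i, R i j * R i l := by
      conv_lhs => rw [hR l, map_sum]
      rw [Finset.mul_sum]
      refine Finset.sum_congr rfl fun i _ => ?_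
      rw [map_smul, h.symm, smul_eq_mul]
      simp only [R, Matrix.of_apply]
      linear_combination -(ε * g (a i) (a' l) * g (a i) (a' j)) * h.mul_self
    rw [Matrix.mul_apply]
    simp only [Matrix.transpose_apply]
    apply mul_left_cancel₀ h.ne_zero
    rw [← h1]
    rcases eq_or_ne j l with rfl | hjl
    · simp [h'.norm]
    · simp [Matrix.one_apply_ne hjl, h'.orthogonal j l hjl]
  have hdet : R.det * R.det = 1 := by
    have := congrArg Matrix.det hRR
    rwa [Matrix.det_mul, Matrix.det_transpose, Matrix.det_one] at this
  -- The change of basis from w to w' is block diagonal, with blocks R and the change from u to u';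
  -- the orientation hypotheses therefore give det R > 0.
  have hblock : w.det w' = R.det * u.det u' := by
    rw [Module.Basis.det_apply, Module.Basis.det_apply,
      ← Matrix.det_submatrix_equiv_self finSumFinEquiv]
    have h2 : (w.toMatrix w').submatrix finSumFinEquiv finSumFinEquiv =
        Matrix.fromBlocks R 0 0 (u.toMatrix u') := by
      have hwa : ∀ i, a i = w (Fin.castAdd d i) := fun i => by simp [h.coe_eq]
      have hwu : ∀ i, A (u i) = w (Fin.natAdd k i) := fun i => by simp [h.coe_eq]
      have ha' : ∀ j, w' (Fin.castAdd d j) = ∑ i, R i j • w (Fin.castAdd d i) := fun j => by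
        rw [h'.coe_eq, Fin.append_left, hR j]
        exact Finset.sum_congr rfl fun i _ => by rw [hwa]
      have hu' : ∀ j, w' (Fin.natAdd k j) = ∑ i, u.toMatrix u' i j • w (Fin.natAdd k i) :=
        fun j => by
          rw [h'.coe_eq, Fin.append_right, Function.comp_apply]
          conv_lhs => rw [← u.sum_repr (u' j), map_sum]
          exact Finset.sum_congr rfl fun i _ => by rw [map_smul, hwu]; rfl
      ext i j
      rcases i with i | i <;> rcases j with j | j
      · simp only [Matrix.submatrix_apply, finSumFinEquiv_apply_left, Module.Basis.toMatrix_apply,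
          ha', map_sum, map_smul, Module.Basis.repr_self, Finsupp.coe_finsetSum, Finset.sum_apply,
          Finsupp.smul_single, Finsupp.single_apply, Matrix.fromBlocks_apply₁₁]
        simp
      · simp only [Matrix.submatrix_apply, finSumFinEquiv_apply_left, finSumFinEquiv_apply_right,
          Module.Basis.toMatrix_apply, hu', map_sum, map_smul, Module.Basis.repr_self,
          Finsupp.coe_finsetSum, Finset.sum_apply, Finsupp.smul_single, Finsupp.single_apply,
          Matrix.fromBlocks_apply₁₂]
        refine Finset.sum_eq_zero fun l _ => if_neg fun e => ?_
        simp [Fin.ext_iff] at e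
        omega
      · simp only [Matrix.submatrix_apply, finSumFinEquiv_apply_left, finSumFinEquiv_apply_right,
          Module.Basis.toMatrix_apply, ha', map_sum, map_smul, Module.Basis.repr_self,
          Finsupp.coe_finsetSum, Finset.sum_apply, Finsupp.smul_single, Finsupp.single_apply,
          Matrix.fromBlocks_apply₂₁]
        refine Finset.sum_eq_zero fun l _ => if_neg fun e => ?_
        simp [Fin.ext_iff] at e
        omega
      · simp only [Matrix.submatrix_apply, finSumFinEquiv_apply_right,
          Module.Basis.toMatrix_apply, hu', map_sum, map_smul, Module.Basis.repr_self,
          Finsupp.coe_finsetSum, Finset.sum_apply, Finsupp.smul_single, Finsupp.single_apply,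
          Matrix.fromBlocks_apply₂₂]
        simp
    rw [h2, Matrix.det_fromBlocks_zero₂₁]
  have hpos : 0 < R.det := by
    have h3 := (Module.Basis.orientation_eq_iff_det_pos w w').1 hw
    have h4 := (Module.Basis.orientation_eq_iff_det_pos u u').1 hu
    rw [hblock] at h3
    exact pos_of_mul_pos_left h3 h4.le
  have hone : R.det = 1 := by nlinarith
  -- Pulled back along e_i ↦ a i, F is a multiple of the determinant on ℝ^k, so passing from a to a'
  -- multiplies its value by det R = 1.
  have h5 := (F.compLinearMap (Fintype.linearCombination ℝ a)).eq_smul_basis_det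
    (Pi.basisFun ℝ (Fin k))
  have h6 := congrArg (fun G => G fun j i => R i j) h5
  simp only [AlternatingMap.compLinearMap_apply, AlternatingMap.smul_apply] at h6
  have h7 : (Pi.basisFun ℝ (Fin k)).det (fun j i => R i j) = 1 := by
    rw [Pi.basisFun_det_apply]
    exact (Matrix.det_transpose R).trans hone
  have h8 : (fun j => Fintype.linearCombination ℝ a fun i => R i j) = a' := by
    funext j
    rw [Fintype.linearCombination_apply, hR]
  have h9 : (fun j => Fintype.linearCombination ℝ a (Pi.basisFun ℝ (Fin k) j)) = a := by
    funext j
    simp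
  rw [h7, h8, h9, smul_eq_mul, mul_one] at h6
  exact h6.symm

end IsAdapted

end Frames

/-! ### Gray's structure and its volume form at one point. -/

section Frames

variable {V T : Type*} [AddCommGroup V] [Module ℝ V] [AddCommGroup T] [Module ℝ T]
  {g : V →ₗ[ℝ] V →ₗ[ℝ] ℝ} {A : T →ₗ[ℝ] V}

/-- Pairing a relation with a j isolates the coefficient of a j; what remains is the image of a
relation among the u i. -/
theorem linearIndependent_append {k d : ℕ} (hA : Function.Injective A) {a : Fin k → V}
    (ha : ∀ i, g (a i) (a i) ≠ 0) (haa : ∀ i j, i ≠ j → g (a i) (a j) = 0)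
    (han : ∀ i v, g (a i) (A v) = 0) {u : Fin d → T} (hu : LinearIndependent ℝ u) :
    LinearIndependent ℝ (Fin.append a (A ∘ u)) := by
  rw [Fintype.linearIndependent_iff]
  intro c hc
  simp only [Fin.sum_univ_add, Fin.append_left, Fin.append_right, Function.comp_apply] at hc
  have h1 : ∀ j, c (Fin.castAdd d j) = 0 := fun j => by
    have h2 := congrArg (g (a j)) hc
    rw [map_add, map_sum, map_sum, map_zero, Finset.sum_eq_single j] at h2
    · simpa [han, ha j] using h2
    · intro i _ hij
      simp [haa j i hij.symm]
    · simp
  have h3 : A (∑ i, c (Fin.natAdd k i) • u i) = 0 := by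
    simpa [h1] using hc
  have h4 := Fintype.linearIndependent_iff.1 hu _ (hA (h3.trans (map_zero A).symm))
  intro i
  induction i using Fin.addCases with
  | left i => exact h1 i
  | right i => exact h4 i

theorem exists_basis_append {k d : ℕ} (hA : Function.Injective A) {a : Fin k → V}
    (ha : ∀ i, g (a i) (a i) ≠ 0) (haa : ∀ i j, i ≠ j → g (a i) (a j) = 0)
    (han : ∀ i v, g (a i) (A v) = 0) (u : Module.Basis (Fin d) ℝ T)
    (hV : Module.finrank ℝ V = k + d) (hpos : 0 < k + d) :
    ∃ w : Module.Basis (Fin (k + d)) ℝ V, ⇑w = Fin.append a (A ∘ u) := by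
  have : Nonempty (Fin (k + d)) := ⟨⟨0, hpos⟩⟩
  refine ⟨basisOfLinearIndependentOfCardEqFinrank
    (linearIndependent_append hA ha haa han u.linearIndependent) (by simp [hV]), ?_⟩
  simp

/-- A normal orthonormal family that is one vector short extends to an oriented frame. -/
theorem exists_oriented_extension {m d : ℕ} (hA : Function.Injective A)
    (hsymm : ∀ u v, g u v = g v u) (hnd : ∀ u, (∀ w, g u w = 0) → u = 0) {ε : ℝ} (hε : |ε| = 1)
    (hdef : ∀ w, (∀ v, g w (A v) = 0) → w ≠ 0 → 0 < ε * g w w)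
    {p : Fin m → V} (hp : ∀ i, g (p i) (p i) = ε) (hpp : ∀ i j, i ≠ j → g (p i) (p j) = 0)
    (hpn : ∀ i v, g (p i) (A v) = 0) (u : Module.Basis (Fin d) ℝ T)
    (hV : Module.finrank ℝ V = m + 1 + d) (o : Orientation ℝ V (Fin (m + 1 + d))) :
    ∃ (e : V) (w : Module.Basis (Fin (m + 1 + d)) ℝ V), w.orientation = o ∧
      IsAdapted g A ε (Fin.snoc (α := fun _ => V) p e : Fin (m + 1) → V) u w := by
  have hfin : Module.Finite ℝ V := Module.finite_of_finrank_pos (by omega)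
  have hεε : ε * ε = 1 := by rw [← abs_mul_abs_self, hε, one_mul]
  have hε0 : ε ≠ 0 := fun h0 => by simp [h0] at hεε
  -- Orthogonality to p and to the images of u is m + d linear conditions in dimension m + 1 + d, so
  -- a nonzero solution exists.
  obtain ⟨z, hz, hz0⟩ : ∃ z : V, z ∈ LinearMap.ker (LinearMap.prod
      (LinearMap.pi fun i => g (p i)) (LinearMap.pi fun j => g (A (u j)))) ∧ z ≠ 0 := by
    apply (Submodule.ne_bot_iff _).1
    apply LinearMap.ker_ne_bot_of_finrank_lt
    simp [hV]
  have hzp : ∀ i, g (p i) z = 0 := fun i =>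
    congrFun (congrArg Prod.fst (LinearMap.mem_ker.1 hz)) i
  have hzu : ∀ j, g (A (u j)) z = 0 := fun j =>
    congrFun (congrArg Prod.snd (LinearMap.mem_ker.1 hz)) j
  have hzn : ∀ v, g z (A v) = 0 := fun v => by
    rw [← u.sum_repr v, map_sum, map_sum]
    exact Finset.sum_eq_zero fun j _ => by rw [map_smul, map_smul, hsymm, hzu, smul_zero]
  have hzz := hdef z hzn hz0
  set r := (Real.sqrt (ε * g z z))⁻¹ with hr
  have hr2 : r * r * (ε * g z z) = 1 := by
    have h1 := Real.mul_self_sqrt hzz.le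
    have h2 : Real.sqrt (ε * g z z) ≠ 0 := (Real.sqrt_pos.2 hzz).ne'
    rw [hr]
    field_simp
    rw [sq]
    exact h1.symm
  -- Both unit vectors on the line of z are admissible (s = ±1); one of them gives the prescribed
  -- orientation.
  have key : ∀ s : ℝ, s * s = 1 → ∃ w : Module.Basis (Fin (m + 1 + d)) ℝ V,
      IsAdapted g A ε (Fin.snoc (α := fun _ => V) p ((s * r) • z) : Fin (m + 1) → V) u w := by
    intro s hs
    have h1 : ∀ i, g ((Fin.snoc (α := fun _ => V) p ((s * r) • z) : Fin (m + 1) → V) i)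
        ((Fin.snoc (α := fun _ => V) p ((s * r) • z) : Fin (m + 1) → V) i) = ε := fun i => by
      induction i using Fin.lastCases with
      | last =>
        simp only [Fin.snoc_last, map_smul, LinearMap.smul_apply, smul_eq_mul]
        linear_combination ε * hr2 - r * r * g z z * hεε + r * r * g z z * hs
      | cast i => simp [hp]
    have h2 : ∀ i j, i ≠ j → g ((Fin.snoc (α := fun _ => V) p ((s * r) • z) : Fin (m + 1) → V) i)
        ((Fin.snoc (α := fun _ => V) p ((s * r) • z) : Fin (m + 1) → V) j) = 0 := fun i j hij => by
      induction i using Fin.lastCases with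
      | last =>
        induction j using Fin.lastCases with
        | last => exact absurd rfl hij
        | cast j => simp [hsymm z, hzp]
      | cast i =>
        induction j using Fin.lastCases with
        | last => simp [hzp]
        | cast j =>
          simpa using hpp i j fun e => hij (by rw [e])
    have h3 : ∀ i v, g ((Fin.snoc (α := fun _ => V) p ((s * r) • z) : Fin (m + 1) → V) i) (A v) =
        0 := fun i v => by
      induction i using Fin.lastCases with
      | last => simp [hzn]
      | cast i => simp [hpn]
    obtain ⟨w, hw⟩ := exists_basis_append hA (fun i => by rw [h1 i]; exact hε0) h2 h3 u hV
      (by omega)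
    exact ⟨w, hsymm, hnd, hε, h1, h2, h3, hw⟩
  obtain ⟨w, hw⟩ := key 1 (by norm_num)
  obtain ⟨w', hw'⟩ := key (-1) (by norm_num)
  rcases w.orientation_eq_or_eq_neg o with ho | ho
  · exact ⟨_, w, ho.symm, hw⟩
  · refine ⟨_, w', ?_, hw'⟩
    -- The basis for s = -1 is the one for s = 1 with the last normal vector negated, which reverses
    -- the orientation.
    rw [ho, ← w.orientation_neg_single (Fin.castAdd d (Fin.last m))]
    congr 1
    ext i
    rw [Module.Basis.unitsSMul_apply, hw.coe_eq, hw'.coe_eq]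
    induction i using Fin.addCases with
    | left i =>
      induction i using Fin.lastCases with
      | last => simp [Units.smul_def]
      | cast i =>
        rw [Function.update_of_ne]
        · simp
        · simp [Fin.ext_iff]
          omega
    | right i =>
      rw [Function.update_of_ne]
      · simp
      · simp [Fin.ext_iff]
        omega

/-- The algebra of Gray's structure `J v = -X(a₁, …, a_k, v)` at a point. -/
structure IsGrayAt {m : ℕ} (A : T →ₗ[ℝ] V)
    (X : MultilinearMap ℝ (fun _ : Fin (m + 1 + 1) => V) V) (a : Fin (m + 1) → V)
    (J : T → T) : Prop where
  map_eq : ∀ v, A (J v) = -X (Fin.snoc (α := fun _ => V) a (A v))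

variable {m d : ℕ} {X : MultilinearMap ℝ (fun _ : Fin (m + 1 + 1) => V) V} {a : Fin (m + 1) → V}
  {ε : ℝ} {u : Module.Basis (Fin d) ℝ T} {w : Module.Basis (Fin (m + 1 + d)) ℝ V} {J : T → T}

/-- The product is orthogonal to its arguments a, and the orthogonal complement of the normal frame
is the image of A. -/
theorem IsAdapted.exists_gray (h : IsAdapted g A ε a u w) (hX : IsVectorCross g X) (v : T) :
    ∃ q, A q = -X (Fin.snoc (α := fun _ => V) a (A v)) := by
  obtain ⟨q, hq⟩ := h.exists_eq_of_mem_perp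
    (z := -X (Fin.snoc (α := fun _ => V) a (A v))) fun i => by
      have h1 := hX.orthogonal (Fin.snoc (α := fun _ => V) a (A v)) i.castSucc
      rw [Fin.snoc_castSucc] at h1
      rw [map_neg, h.symm, h1, neg_zero]
  exact ⟨q, hq.symm⟩

theorem apply_snoc_eq_lastPair (X : MultilinearMap ℝ (fun _ : Fin (m + 1 + 1) => V) V)
    (a : Fin (m + 1) → V) (z : V) : X (Fin.snoc (α := fun _ => V) a z) =
      lastPair X (fun i => a i.castSucc) (a (Fin.last m)) z := by
  rw [lastPair_apply]
  congr 2
  exact (Fin.snoc_init_self a).symm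

theorem IsAdapted.isCrossProductOn (h : IsAdapted g A ε a u w) (hX : IsVectorCross g X)
    (hm : m = 0 ∨ m = 1) :
    IsCrossProductOn (ε ^ m • g) (perp g fun i : Fin m => a i.castSucc)
      (lastPair X fun i : Fin m => a i.castSucc) :=
  hX.isCrossProductOn hm h.unit (fun _ => h.norm _) fun _ _ hij =>
    h.orthogonal _ _ fun e => hij (Fin.castSucc_injective _ e)

theorem IsAdapted.last_mem (h : IsAdapted g A ε a u w) :
    a (Fin.last m) ∈ perp g fun i : Fin m => a i.castSucc :=
  fun _ => h.orthogonal _ _ (Fin.castSucc_lt_last _).ne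

theorem IsAdapted.map_mem (h : IsAdapted g A ε a u w) (v : T) :
    A v ∈ perp g fun i : Fin m => a i.castSucc :=
  fun _ => h.normal _ _

/-- This is `double` for the last frame vector, whose square under ε^m g is ε^(m+1) = 1. The two
minus signs in the formula for J cancel. -/
theorem IsGrayAt.sq (hJ : IsGrayAt A X a J) (h : IsAdapted g A ε a u w)
    (hX : IsVectorCross g X) (hm : m = 0 ∨ m = 1) (hε : ε ^ (m + 1) = 1)
    (hA : Function.Injective A) (v : T) : J (J v) = -v := by
  apply hA
  rw [map_neg, hJ.map_eq, hJ.map_eq, apply_snoc_eq_lastPair, apply_snoc_eq_lastPair, map_neg,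
    (h.isCrossProductOn hX hm).double (h.map_mem v) h.last_mem]
  simp only [LinearMap.smul_apply, smul_eq_mul, h.norm, h.normal]
  rw [← pow_succ, hε]
  simp

/-- The real part of the complex volume form. -/
def realVolume (g : V →ₗ[ℝ] V →ₗ[ℝ] ℝ) (A : T →ₗ[ℝ] V)
    (X : MultilinearMap ℝ (fun _ : Fin (m + 1 + 1) => V) V) (p : Fin m → V) (x y z : T) : ℝ :=
  g (lastPair X p (A x) (A y)) (A z)

theorem IsAdapted.realVolume_swap₁₂ (h : IsAdapted g A ε a u w) (hX : IsVectorCross g X)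
    (hm : m = 0 ∨ m = 1) (x y z : T) : realVolume g A X (fun i => a i.castSucc) x y z =
      -realVolume g A X (fun i => a i.castSucc) y x z := by
  unfold realVolume
  rw [(h.isCrossProductOn hX hm).swap (h.map_mem x) (h.map_mem y)]
  simp

theorem IsAdapted.realVolume_swap₂₃ (h : IsAdapted g A ε a u w) (hX : IsVectorCross g X)
    (hm : m = 0 ∨ m = 1) (x y z : T) : realVolume g A X (fun i => a i.castSucc) x y z =
      -realVolume g A X (fun i => a i.castSucc) x z y := by
  have h1 := (h.isCrossProductOn hX hm).skew_right (h.map_mem x) (h.map_mem y) (h.map_mem z)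
  apply mul_left_cancel₀ (pow_ne_zero m h.ne_zero)
  simpa [realVolume] using h1

/-- On the image of A, J is minus the product with the last frame vector. The sign occurs once on
each side, so `middle` applies, and the nonzero factor ε^m is cancelled. -/
theorem IsGrayAt.realVolume_middle (hJ : IsGrayAt A X a J) (h : IsAdapted g A ε a u w)
    (hX : IsVectorCross g X) (hm : m = 0 ∨ m = 1) (x y z : T) :
    realVolume g A X (fun i => a i.castSucc) (J x) y z =
      realVolume g A X (fun i => a i.castSucc) x (J y) z := by
  have h0 : ∀ v, (ε ^ m • g) (a (Fin.last m)) (A v) = 0 := fun v => by simp [h.normal]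
  have h1 := (h.isCrossProductOn hX hm).middle h.last_mem (h.map_mem x) (h.map_mem y)
    (h0 x) (h0 y) (h0 z)
  apply mul_left_cancel₀ (pow_ne_zero m h.ne_zero)
  simpa [realVolume, hJ.map_eq, apply_snoc_eq_lastPair] using h1

/-- The image of A is exactly the complement of the last frame vector inside the complement of the
others, which is the space W of `exists_ne_zero`. -/
theorem IsAdapted.exists_realVolume_ne_zero (h : IsAdapted g A ε a u w) (hX : IsVectorCross g X)
    (hm : m = 0 ∨ m = 1) (hε : ε ^ (m + 1) = 1) (hA : Function.Injective A) (hd : 3 ≤ d) :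
    ∃ x y z, realVolume g A X (fun i => a i.castSucc) x y z ≠ 0 := by
  have h1 : ∀ z, z ∈ LinearMap.range A ↔ z ∈ (perp g fun i : Fin m => a i.castSucc) ∧
      (ε ^ m • g) (a (Fin.last m)) z = 0 := by
    refine fun z => ⟨?_, fun hz => ?_⟩
    · rintro ⟨v, rfl⟩
      exact ⟨h.map_mem v, by simp [h.normal]⟩
    · obtain ⟨v, hv⟩ := h.exists_eq_of_mem_perp (z := z) fun i => by
        induction i using Fin.lastCases with
        | last => simpa [h.ne_zero] using hz.2
        | cast i => exact hz.1 i
      exact ⟨v, hv.symm⟩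
  obtain ⟨_, ⟨x, rfl⟩, _, ⟨y, rfl⟩, _, ⟨z, rfl⟩, hne⟩ :=
    (h.isCrossProductOn hX hm).exists_ne_zero h.last_mem
      (by simpa [h.norm, pow_succ] using hε) h1
      (by rw [LinearMap.finrank_range_of_inj hA, Module.finrank_eq_card_basis u]; simpa using hd)
  refine ⟨x, y, z, fun h0 => hne ?_⟩
  unfold realVolume at h0
  simp [h0]

end Frames

/-! ### Smooth tangent fields along a map. -/

section Along

variable {n : ℕ} {N : Type*} [TopologicalSpace N] [ChartedSpace (EuclideanSpace ℝ (Fin n)) N]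
  [IsManifold (𝓡 n) ∞ N]
  {E : Type*} [NormedAddCommGroup E] [NormedSpace ℝ E] {H : Type*} [TopologicalSpace H]
  {I : ModelWithCorners ℝ E H} {P : Type*} [TopologicalSpace P] [ChartedSpace H P]

/-- The coordinates of tangent vectors in the trivialization around `y₀`. -/
def tangentCoord (n : ℕ) {N : Type*} [TopologicalSpace N]
    [ChartedSpace (EuclideanSpace ℝ (Fin n)) N] [IsManifold (𝓡 n) ∞ N] (y₀ y : N) :
    TangentSpace (𝓡 n) y →L[ℝ] EuclideanSpace ℝ (Fin n) :=
  (trivializationAt (EuclideanSpace ℝ (Fin n)) (TangentSpace (𝓡 n)) y₀).continuousLinearMapAt ℝ y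

/-- The tangent vector with given coordinates in the trivialization around `y₀`. -/
def tangentVec (n : ℕ) {N : Type*} [TopologicalSpace N]
    [ChartedSpace (EuclideanSpace ℝ (Fin n)) N] [IsManifold (𝓡 n) ∞ N] (y₀ y : N) :
    EuclideanSpace ℝ (Fin n) →L[ℝ] TangentSpace (𝓡 n) y :=
  (trivializationAt (EuclideanSpace ℝ (Fin n)) (TangentSpace (𝓡 n)) y₀).symmL ℝ y

/-- The open set on which the trivialization around `y₀` is defined. -/
def tangentDomain (n : ℕ) {N : Type*} [TopologicalSpace N]
    [ChartedSpace (EuclideanSpace ℝ (Fin n)) N] [IsManifold (𝓡 n) ∞ N] (y₀ : N) : Opens N :=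
  ⟨(trivializationAt (EuclideanSpace ℝ (Fin n)) (TangentSpace (𝓡 n) : N → Type _) y₀).baseSet,
    (trivializationAt (EuclideanSpace ℝ (Fin n)) (TangentSpace (𝓡 n)) y₀).open_baseSet⟩

theorem mem_tangentDomain (y₀ : N) : y₀ ∈ tangentDomain n y₀ :=
  FiberBundle.mem_baseSet_trivializationAt' y₀

theorem tangentVec_tangentCoord {y₀ y : N} (hy : y ∈ tangentDomain n y₀)
    (v : TangentSpace (𝓡 n) y) : tangentVec n y₀ y (tangentCoord n y₀ y v) = v :=
  Trivialization.symmL_continuousLinearMapAt _ hy v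

theorem tangentCoord_tangentVec {y₀ y : N} (hy : y ∈ tangentDomain n y₀)
    (v : EuclideanSpace ℝ (Fin n)) : tangentCoord n y₀ y (tangentVec n y₀ y v) = v :=
  Trivialization.continuousLinearMapAt_symmL _ hy v

theorem tangentCoord_apply {y₀ y : N} (hy : y ∈ tangentDomain n y₀)
    (v : TangentSpace (𝓡 n) y) : tangentCoord n y₀ y v =
      (trivializationAt (EuclideanSpace ℝ (Fin n)) (TangentSpace (𝓡 n)) y₀ ⟨y, v⟩).2 :=
  congrFun (Trivialization.coe_linearMapAt_of_mem _ hy) v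

theorem eventually_mem_tangentDomain {F : P → N} {x₀ : P}
    (hF : ContinuousAt F x₀) :
    ∀ᶠ x in nhds x₀, F x ∈ tangentDomain n (F x₀) :=
  hF.eventually ((tangentDomain n (F x₀)).isOpen.mem_nhds (mem_tangentDomain (n := n) _))

/-- Smoothness at x₀ may be read in the single trivialization around F x₀. Using `tangentCoord`
makes the coordinates linear in s at every x, not only near x₀. -/
theorem contMDiffAt_along_iff {k : WithTop ℕ∞} {F : P → N} {s : ∀ x, TangentSpace (𝓡 n) (F x)}
    {x₀ : P} : ContMDiffAt I (𝓡 n).tangent k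
      (fun x => (⟨F x, s x⟩ : TangentBundle (𝓡 n) N)) x₀ ↔
    ContMDiffAt I (𝓡 n) k F x₀ ∧ ContMDiffAt I 𝓘(ℝ, EuclideanSpace ℝ (Fin n)) k
      (fun x => tangentCoord n (F x₀) (F x) (s x)) x₀ := by
  refine Bundle.contMDiffAt_totalSpace.trans (and_congr_right fun hF => ?_)
  refine Filter.EventuallyEq.contMDiffAt_iff ?_
  filter_upwards [eventually_mem_tangentDomain (n := n) hF.continuousAt] with x hx
  exact (tangentCoord_apply hx _).symm

/-- A tangent field with constant coordinates is smooth. -/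
theorem contMDiffOn_tangentVec (y₀ : N) (v : EuclideanSpace ℝ (Fin n)) :
    ContMDiffOn (𝓡 n) (𝓡 n).tangent ∞
      (fun y => (⟨y, tangentVec n y₀ y v⟩ : TangentBundle (𝓡 n) N)) (tangentDomain n y₀) := by
  refine ((trivializationAt (EuclideanSpace ℝ (Fin n)) (TangentSpace (𝓡 n) : N → Type _)
    y₀).contMDiffOn_section_baseSet_iff).2 ?_
  refine (contMDiffOn_const (c := v)).congr fun y hy => ?_
  exact (tangentCoord_apply (n := n) hy _).symm.trans (tangentCoord_tangentVec hy v)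

theorem contMDiffAt_along_comp {k : WithTop ℕ∞} {F : P → N} {x₀ : P}
    (hF : ContMDiffAt I (𝓡 n) k F x₀) (hk : k ≤ ∞) {s : ∀ y : N, TangentSpace (𝓡 n) y}
    {U : Opens N} (hU : F x₀ ∈ U) (hs : ContMDiffOn (𝓡 n) (𝓡 n).tangent ∞
      (fun y => (⟨y, s y⟩ : TangentBundle (𝓡 n) N)) U) :
    ContMDiffAt I (𝓡 n).tangent k (fun x => (⟨F x, s (F x)⟩ : TangentBundle (𝓡 n) N)) x₀ :=
  ContMDiffAt.comp (g := fun y => (⟨y, s y⟩ : TangentBundle (𝓡 n) N)) x₀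
    ((hs.contMDiffAt (U.isOpen.mem_nhds hU)).of_le hk) hF

theorem ContMDiffAt.smul_along {k : WithTop ℕ∞} {F : P → N} {s : ∀ x, TangentSpace (𝓡 n) (F x)}
    {c : P → ℝ} {x₀ : P} (hc : ContMDiffAt I 𝓘(ℝ) k c x₀) (hs : ContMDiffAt I (𝓡 n).tangent k
      (fun x => (⟨F x, s x⟩ : TangentBundle (𝓡 n) N)) x₀) :
    ContMDiffAt I (𝓡 n).tangent k
      (fun x => (⟨F x, c x • s x⟩ : TangentBundle (𝓡 n) N)) x₀ := by
  rw [contMDiffAt_along_iff] at hs ⊢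
  refine ⟨hs.1, ?_⟩
  simp only [map_smul]
  exact hc.smul hs.2

/-- A vector cross product of smooth fields along a map is smooth. -/
theorem VectorCrossProduct.contMDiffAt {k : WithTop ℕ∞} (hk : k ≤ ∞)
    {g : PseudoRiemannianMetric n N} {r : ℕ} (X : VectorCrossProduct g r) {F : P → N} {x₀ : P}
    (hF : ContMDiffAt I (𝓡 n) k F x₀) {s : Fin r → ∀ x, TangentSpace (𝓡 n) (F x)}
    (hs : ∀ i, ContMDiffAt I (𝓡 n).tangent k
      (fun x => (⟨F x, s i x⟩ : TangentBundle (𝓡 n) N)) x₀) :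
    ContMDiffAt I (𝓡 n).tangent k
      (fun x => (⟨F x, X.toFun (F x) fun i => s i x⟩ : TangentBundle (𝓡 n) N)) x₀ := by
  let b := EuclideanSpace.basisFun (Fin n) ℝ
  rw [contMDiffAt_along_iff]
  refine ⟨hF, ?_⟩
  -- The smoothness axiom of X concerns vector fields on open sets of N, not fields along F. It is
  -- applied to constant-coordinate fields, and multilinearity expands a general field in these with
  -- smooth coefficients.
  have h1 : ∀ ρ : Fin r → Fin n, ContMDiffAt I 𝓘(ℝ, EuclideanSpace ℝ (Fin n)) k (fun x =>
      tangentCoord n (F x₀) (F x) (X.toFun (F x) fun i => tangentVec n (F x₀) (F x) (b (ρ i))))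
      x₀ := fun ρ =>
    (contMDiffAt_along_iff.1 (contMDiffAt_along_comp hF hk (mem_tangentDomain _)
      (X.smooth (tangentDomain n (F x₀)) (fun i y => tangentVec n (F x₀) y (b (ρ i)))
        fun i => contMDiffOn_tangentVec _ _))).2
  have h2 : ∀ i j, ContMDiffAt I 𝓘(ℝ) k
      (fun x => tangentCoord n (F x₀) (F x) (s i x) j) x₀ := fun i j =>
    ((EuclideanSpace.proj (𝕜 := ℝ) j).contMDiff.contMDiffAt).comp x₀
      (contMDiffAt_along_iff.1 (hs i)).2
  have h3 : ContMDiffAt I 𝓘(ℝ, EuclideanSpace ℝ (Fin n)) k (fun x => ∑ ρ : Fin r → Fin n,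
      (∏ i, tangentCoord n (F x₀) (F x) (s i x) (ρ i)) •
        tangentCoord n (F x₀) (F x) (X.toFun (F x) fun i => tangentVec n (F x₀) (F x) (b (ρ i))))
      x₀ := by
    refine contMDiffAt_finsetSum fun ρ _ => ?_
    have h5 : ContMDiffAt I 𝓘(ℝ) k
        (fun x => ∏ i, tangentCoord n (F x₀) (F x) (s i x) (ρ i)) x₀ :=
      contMDiffAt_finsetProd fun i _ => h2 i (ρ i)
    exact h5.smul (h1 ρ)
  refine h3.congr_of_eventuallyEq ?_
  filter_upwards [eventually_mem_tangentDomain (n := n) hF.continuousAt] with x hx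
  have h4 : (fun i => s i x) = fun i => ∑ j, tangentCoord n (F x₀) (F x) (s i x) j •
      tangentVec n (F x₀) (F x) (b j) := by
    funext i
    conv_lhs => rw [← tangentVec_tangentCoord hx (s i x),
      ← b.sum_repr (tangentCoord n (F x₀) (F x) (s i x)), map_sum]
    simp [b]
  rw [h4, MultilinearMap.map_sum, map_sum]
  refine Finset.sum_congr rfl fun ρ _ => ?_
  rw [MultilinearMap.map_smul_univ, map_smul]

/-- The inner product of smooth fields along a map is smooth. -/
theorem PseudoRiemannianMetric.contMDiffAt {k : WithTop ℕ∞} (hk : k ≤ ∞)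
    (g : PseudoRiemannianMetric n N) {F : P → N} {x₀ : P}
    {s t : ∀ x, TangentSpace (𝓡 n) (F x)}
    (hs : ContMDiffAt I (𝓡 n).tangent k (fun x => (⟨F x, s x⟩ : TangentBundle (𝓡 n) N)) x₀)
    (ht : ContMDiffAt I (𝓡 n).tangent k (fun x => (⟨F x, t x⟩ : TangentBundle (𝓡 n) N)) x₀) :
    ContMDiffAt I 𝓘(ℝ) k (fun x => g.inner (F x) (s x) (t x)) x₀ := by
  have hF := (contMDiffAt_along_iff.1 hs).1
  have h1 := ContMDiffAt.clm_bundle_apply₂ (F₁ := EuclideanSpace ℝ (Fin n))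
    (F₂ := EuclideanSpace ℝ (Fin n)) (F₃ := ℝ) (E₃ := fun _ : N => ℝ)
    (ψ := fun x => g.inner (F x)) (b := F)
    (((g.smooth.of_le hk).contMDiffAt (x := F x₀)).comp x₀ hF) hs ht
  exact (Bundle.contMDiffAt_totalSpace.1 h1).2

end Along

/-! ### Smooth families of linear maps and their inverses. -/

section LinearFamilies

variable {E : Type*} [NormedAddCommGroup E] [NormedSpace ℝ E] {H : Type*} [TopologicalSpace H]
  {I : ModelWithCorners ℝ E H} {P : Type*} [TopologicalSpace P] [ChartedSpace H P]
  {E₁ E₂ : Type*} [NormedAddCommGroup E₁] [NormedSpace ℝ E₁] [FiniteDimensional ℝ E₁]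
  [NormedAddCommGroup E₂] [NormedSpace ℝ E₂] {k : WithTop ℕ∞} {x₀ : P}

/-- A family of linear maps on a finite-dimensional space is smooth if it is pointwise smooth. -/
theorem contMDiffAt_clm_of_apply {K : P → E₁ →L[ℝ] E₂}
    (hK : ∀ v, ContMDiffAt I 𝓘(ℝ, E₂) k (fun x => K x v) x₀) :
    ContMDiffAt I 𝓘(ℝ, E₁ →L[ℝ] E₂) k K x₀ := by
  let b := Module.finBasis ℝ E₁
  -- K x is the sum of the rank-one maps built from the coordinate functionals and the vectors K x
  -- (b i).
  have h1 : K = fun x => ∑ i, ContinuousLinearMap.smulRightL ℝ E₁ E₂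
      (LinearMap.toContinuousLinearMap (b.coord i)) (K x (b i)) := by
    funext x
    ext v
    conv_lhs => rw [← b.sum_repr v, map_sum]
    simp
  rw [h1]
  exact contMDiffAt_finsetSum fun i _ =>
    ((ContinuousLinearMap.smulRightL ℝ E₁ E₂
      (LinearMap.toContinuousLinearMap (b.coord i))).contMDiff.contMDiffAt).comp x₀ (hK (b i))

theorem exists_equiv_of_injective {K : E₁ →L[ℝ] E₁} (hK : Function.Injective K) :
    ∃ e : E₁ ≃L[ℝ] E₁, (e : E₁ →L[ℝ] E₁) = K :=
  ⟨(LinearEquiv.ofInjectiveEndo K.toLinearMap hK).toContinuousLinearEquiv, by ext v; rfl⟩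

theorem contMDiffAt_inverse_apply {K : P → E₁ →L[ℝ] E₁} (hK : ContMDiffAt I 𝓘(ℝ, E₁ →L[ℝ] E₁) k K x₀)
    (hinj : Function.Injective (K x₀)) {y : P → E₁} (hy : ContMDiffAt I 𝓘(ℝ, E₁) k y x₀) :
    ContMDiffAt I 𝓘(ℝ, E₁) k (fun x => (K x).inverse (y x)) x₀ := by
  have := FiniteDimensional.complete ℝ E₁
  obtain ⟨e, he⟩ := exists_equiv_of_injective hinj
  have h1 : ContDiffAt ℝ k ContinuousLinearMap.inverse (K x₀) := by
    rw [← he]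
    exact contDiffAt_map_inverse e
  exact (h1.contMDiffAt.comp x₀ hK).clm_apply hy

/-- Invertible maps form an open set, and an injective endomorphism in finite dimension is
invertible. Only nearby points qualify, since `inverse` takes a default value on other maps. -/
theorem eventually_inverse {K : P → E₁ →L[ℝ] E₁} (hK : ContinuousAt K x₀)
    (hinj : Function.Injective (K x₀)) : ∀ᶠ x in nhds x₀,
      (∀ v, K x ((K x).inverse v) = v) ∧ ∀ v, (K x).inverse (K x v) = v := by
  have := FiniteDimensional.complete ℝ E₁
  obtain ⟨e, he⟩ := exists_equiv_of_injective hinj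
  have h1 := ContinuousLinearEquiv.nhds e
  rw [he] at h1
  filter_upwards [hK.eventually h1] with x hx
  obtain ⟨e', he'⟩ := hx
  rw [← he', ContinuousLinearMap.inverse_equiv]
  exact ⟨e'.apply_symm_apply, e'.symm_apply_apply⟩

end LinearFamilies

/-! ### Recovering smooth fields from their images or inner products. -/

section Maps

variable {n d : ℕ} {N : Type*} [TopologicalSpace N] [ChartedSpace (EuclideanSpace ℝ (Fin n)) N]
  [IsManifold (𝓡 n) ∞ N] {M : Type*} [TopologicalSpace M]
  [ChartedSpace (EuclideanSpace ℝ (Fin d)) M] [IsManifold (𝓡 d) ∞ M]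
  {E : Type*} [NormedAddCommGroup E] [NormedSpace ℝ E] {H : Type*} [TopologicalSpace H]
  {I : ModelWithCorners ℝ E H} {P : Type*} [TopologicalSpace P] [ChartedSpace H P]
  {k : WithTop ℕ∞}

theorem contMDiffAt_mfderiv_along {f : M → N} (hf : ContMDiff (𝓡 d) (𝓡 n) ∞ f) (hk : k ≤ ∞)
    {p : P → M} {u : ∀ x, TangentSpace (𝓡 d) (p x)} {x₀ : P}
    (hu : ContMDiffAt I (𝓡 d).tangent k
      (fun x => (⟨p x, u x⟩ : TangentBundle (𝓡 d) M)) x₀) :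
    ContMDiffAt I (𝓡 n).tangent k
      (fun x => (⟨f (p x), mfderiv (𝓡 d) (𝓡 n) f (p x) (u x)⟩ : TangentBundle (𝓡 n) N)) x₀ :=
  (((hf.contMDiff_tangentMap (m := ∞) le_rfl).of_le hk).contMDiffAt).comp x₀ hu

/-- A field whose image under an immersion is smooth is smooth. -/
theorem contMDiffAt_of_mfderiv {f : M → N} (hf : ContMDiff (𝓡 d) (𝓡 n) ∞ f) {x₀ : M}
    (hinj : Function.Injective (mfderiv (𝓡 d) (𝓡 n) f x₀)) {q : ∀ x, TangentSpace (𝓡 d) x}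
    (hq : ContMDiffAt (𝓡 d) (𝓡 n).tangent ∞
      (fun x => (⟨f x, mfderiv (𝓡 d) (𝓡 n) f x (q x)⟩ : TangentBundle (𝓡 n) N)) x₀) :
    ContMDiffAt (𝓡 d) (𝓡 d).tangent ∞ (fun x => (⟨x, q x⟩ : TangentBundle (𝓡 d) M)) x₀ := by
  let A : M → EuclideanSpace ℝ (Fin d) →L[ℝ] EuclideanSpace ℝ (Fin n) := fun x =>
    (tangentCoord n (f x₀) (f x)).comp ((mfderiv (𝓡 d) (𝓡 n) f x).comp (tangentVec d x₀ x))
  have hA : ContMDiffAt (𝓡 d) 𝓘(ℝ, EuclideanSpace ℝ (Fin d) →L[ℝ] EuclideanSpace ℝ (Fin n)) ∞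
      A x₀ := contMDiffAt_clm_of_apply fun v =>
    (contMDiffAt_along_iff.1 (contMDiffAt_mfderiv_along (p := fun x => x) hf le_rfl
      ((contMDiffOn_tangentVec x₀ v).contMDiffAt
        ((tangentDomain d x₀).isOpen.mem_nhds (mem_tangentDomain x₀))))).2
  have hA0 : Function.Injective (A x₀) := by
    refine Function.Injective.comp (g := tangentCoord n (f x₀) (f x₀)) ?_
      (Function.Injective.comp (g := mfderiv (𝓡 d) (𝓡 n) f x₀) hinj
        (f := tangentVec d x₀ x₀) ?_)
    · exact Function.LeftInverse.injective (tangentVec_tangentCoord (mem_tangentDomain (f x₀)))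
    · exact Function.LeftInverse.injective (tangentCoord_tangentVec (mem_tangentDomain x₀))
  -- One left inverse, chosen at x₀, suffices: L ∘ A x is the identity at x₀ and stays invertible
  -- nearby, so q is its inverse applied to L of the smooth image field.
  obtain ⟨L, hL⟩ := LinearMap.exists_leftInverse_of_injective (A x₀).toLinearMap
    (LinearMap.ker_eq_bot.2 hA0)
  let L' := LinearMap.toContinuousLinearMap L
  have hL' : ∀ v, L' (A x₀ v) = v := fun v => LinearMap.congr_fun hL v
  have hK : ContMDiffAt (𝓡 d) 𝓘(ℝ, EuclideanSpace ℝ (Fin d) →L[ℝ] EuclideanSpace ℝ (Fin d)) ∞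
      (fun x => L'.comp (A x)) x₀ := contMDiffAt_const.clm_comp hA
  have hK0 : Function.Injective (L'.comp (A x₀)) :=
    Function.LeftInverse.injective (g := id) hL'
  refine contMDiffAt_along_iff.2 ⟨contMDiffAt_id, ?_⟩
  have h1 := contMDiffAt_inverse_apply hK hK0
    (L'.contMDiff.contMDiffAt.comp x₀ (contMDiffAt_along_iff.1 hq).2)
  refine h1.congr_of_eventuallyEq ?_
  filter_upwards [eventually_inverse hK.continuousAt hK0,
    eventually_mem_tangentDomain (n := d) continuousAt_id] with x hx hx'
  have h2 := hx.2 (tangentCoord d x₀ x (q x))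
  have h3 : L'.comp (A x) (tangentCoord d x₀ x (q x)) =
      L' (tangentCoord n (f x₀) (f x) (mfderiv (𝓡 d) (𝓡 n) f x (q x))) := by
    change L' (tangentCoord n (f x₀) (f x) (mfderiv (𝓡 d) (𝓡 n) f x
      (tangentVec d x₀ x (tangentCoord d x₀ x (q x))))) = _
    rw [tangentVec_tangentCoord (show x ∈ tangentDomain d x₀ from hx')]
  rw [h3] at h2
  exact h2.symm

/-- An endomorphism field is smooth if it maps fields with constant coordinates to smooth fields. -/
theorem contMDiffAt_endomorphism {J : ∀ x : M, TangentSpace (𝓡 d) x →L[ℝ] TangentSpace (𝓡 d) x}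
    {x₀ : M} (hJ : ∀ v, ContMDiffAt (𝓡 d) (𝓡 d).tangent ∞
      (fun x => (⟨x, J x (tangentVec d x₀ x v)⟩ : TangentBundle (𝓡 d) M)) x₀) :
    ContMDiffAt (𝓡 d)
      ((𝓡 d).prod 𝓘(ℝ, EuclideanSpace ℝ (Fin d) →L[ℝ] EuclideanSpace ℝ (Fin d))) ∞
      (fun x => TotalSpace.mk' (EuclideanSpace ℝ (Fin d) →L[ℝ] EuclideanSpace ℝ (Fin d))
        (E := fun x : M => TangentSpace (𝓡 d) x →L[ℝ] TangentSpace (𝓡 d) x) x (J x)) x₀ := by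
  refine (contMDiffAt_hom_bundle _).2 ⟨contMDiffAt_id, ?_⟩
  exact contMDiffAt_clm_of_apply fun v => (contMDiffAt_along_iff.1 (hJ v)).2

/-- Prescribing the inner products with a local frame defines a smooth field. -/
theorem PseudoRiemannianMetric.exists_contMDiffAt (g : PseudoRiemannianMetric n N) {F : P → N}
    {x₀ : P} (hF : ContMDiffAt I (𝓡 n) ∞ F x₀) {B : Fin n → ∀ x, TangentSpace (𝓡 n) (F x)}
    (hB : ∀ i, ContMDiffAt I (𝓡 n).tangent ∞
      (fun x => (⟨F x, B i x⟩ : TangentBundle (𝓡 n) N)) x₀)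
    (w : Module.Basis (Fin n) ℝ (TangentSpace (𝓡 n) (F x₀))) (hw : ∀ i, w i = B i x₀)
    (c : Fin n → ℝ) : ∃ v : ∀ x, TangentSpace (𝓡 n) (F x), ContMDiffAt I (𝓡 n).tangent ∞
      (fun x => (⟨F x, v x⟩ : TangentBundle (𝓡 n) N)) x₀ ∧
      ∀ᶠ x in nhds x₀, ∀ i, g.inner (F x) (B i x) (v x) = c i := by
  let b := EuclideanSpace.basisFun (Fin n) ℝ
  -- K x sends coordinates of a vector to its inner products with the B i x. At x₀ it is injective
  -- by nondegeneracy, so the prescribed values c can be attained smoothly near x₀.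
  let K : P → EuclideanSpace ℝ (Fin n) →L[ℝ] EuclideanSpace ℝ (Fin n) := fun x =>
    ∑ i, ((g.inner (F x) (B i x)).comp (tangentVec n (F x₀) (F x))).smulRight (b i)
  have hKi : ∀ x v i, K x v i = g.inner (F x) (B i x) (tangentVec n (F x₀) (F x) v) := by
    intro x v i
    simp [K, b, Finset.sum_apply, Pi.single_apply]
  have hvec : ∀ v, ContMDiffAt I (𝓡 n).tangent ∞
      (fun x => (⟨F x, tangentVec n (F x₀) (F x) v⟩ : TangentBundle (𝓡 n) N)) x₀ := fun v =>
    contMDiffAt_along_comp hF le_rfl (mem_tangentDomain _) (contMDiffOn_tangentVec _ v)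
  have hK : ContMDiffAt I 𝓘(ℝ, EuclideanSpace ℝ (Fin n) →L[ℝ] EuclideanSpace ℝ (Fin n)) ∞ K x₀ := by
    refine contMDiffAt_clm_of_apply fun v => ?_
    have h1 : (fun x => K x v) = fun x =>
        ∑ i, g.inner (F x) (B i x) (tangentVec n (F x₀) (F x) v) • b i := by
      funext x
      simp [K]
    rw [h1]
    exact contMDiffAt_finsetSum fun i _ =>
      (g.contMDiffAt le_rfl (hB i) (hvec v)).smul contMDiffAt_const
  have hK0 : Function.Injective (K x₀) := by
    refine (injective_iff_map_eq_zero (K x₀)).2 fun v hv => ?_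
    have h1 : tangentVec n (F x₀) (F x₀) v = 0 := by
      refine g.nondegenerate _ _ fun z => ?_
      rw [g.symm, ← w.sum_repr z, map_sum, sum_apply]
      refine Finset.sum_eq_zero fun i _ => ?_
      rw [map_smul, smul_apply, hw, ← hKi x₀ v i, hv]
      simp
    rw [← tangentCoord_tangentVec (mem_tangentDomain (F x₀)) v, h1, map_zero]
  let y : EuclideanSpace ℝ (Fin n) := WithLp.toLp 2 c
  refine ⟨fun x => tangentVec n (F x₀) (F x) ((K x).inverse y), ?_, ?_⟩
  · refine contMDiffAt_along_iff.2 ⟨hF, ?_⟩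
    refine (contMDiffAt_inverse_apply hK hK0 (contMDiffAt_const (c := y))).congr_of_eventuallyEq ?_
    filter_upwards [eventually_mem_tangentDomain (n := n) hF.continuousAt] with x hx
    exact tangentCoord_tangentVec hx _
  · filter_upwards [eventually_inverse hK.continuousAt hK0] with x hx i
    rw [← hKi, hx.1]

end Maps

/-! ### Orientation is locally constant on continuous frames. -/

section Orientation

variable {n : ℕ} {N : Type*} [TopologicalSpace N] [ChartedSpace (EuclideanSpace ℝ (Fin n)) N]
  [IsManifold (𝓡 n) ∞ N] {P : Type*} [TopologicalSpace P]

theorem continuousAt_tangentCoord {F : P → N} {s : ∀ x, TangentSpace (𝓡 n) (F x)} {x₀ : P}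
    (hs : ContinuousAt (fun x => (⟨F x, s x⟩ : TangentBundle (𝓡 n) N)) x₀) :
    ContinuousAt (fun x => tangentCoord n (F x₀) (F x) (s x)) x₀ := by
  obtain ⟨hF, h⟩ := (FiberBundle.continuousAt_totalSpace (EuclideanSpace ℝ (Fin n)) _).1 hs
  refine h.congr ?_
  filter_upwards [eventually_mem_tangentDomain (n := n) hF] with x hx
  exact (tangentCoord_apply hx _).symm

/-- The trivialization around `y₀` as a linear equivalence. -/
def tangentEquiv {y₀ y : N} (hy : y ∈ tangentDomain n y₀) :
    TangentSpace (𝓡 n) y ≃ₗ[ℝ] EuclideanSpace ℝ (Fin n) :=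
  { (tangentCoord n y₀ y).toLinearMap with
    invFun := tangentVec n y₀ y
    left_inv := tangentVec_tangentCoord hy
    right_inv := tangentCoord_tangentVec hy }

/-- The determinant of the coordinates of tangent vectors. -/
def coordDet (n : ℕ) {N : Type*} [TopologicalSpace N] [ChartedSpace (EuclideanSpace ℝ (Fin n)) N]
    [IsManifold (𝓡 n) ∞ N] (y₀ y : N) : (TangentSpace (𝓡 n) y) [⋀^Fin n]→ₗ[ℝ] ℝ :=
  (EuclideanSpace.basisFun (Fin n) ℝ).toBasis.det.compLinearMap (tangentCoord n y₀ y).toLinearMap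

theorem coordDet_basis_ne_zero {y₀ y : N} (hy : y ∈ tangentDomain n y₀)
    (w : Module.Basis (Fin n) ℝ (TangentSpace (𝓡 n) y)) : coordDet n y₀ y w ≠ 0 :=
  ((EuclideanSpace.basisFun (Fin n) ℝ).toBasis.isUnit_det (w.map (tangentEquiv hy))).ne_zero

theorem coordDet_eq (y₀ : N) {y : N} (b w : Module.Basis (Fin n) ℝ (TangentSpace (𝓡 n) y)) :
    coordDet n y₀ y w = coordDet n y₀ y b * b.det w := by
  conv_lhs => rw [(coordDet n y₀ y).eq_smul_basis_det b]
  rfl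

theorem continuousAt_coordDet {F : P → N} {B : Fin n → ∀ x, TangentSpace (𝓡 n) (F x)} {x₀ : P}
    (hB : ∀ i, ContinuousAt (fun x => (⟨F x, B i x⟩ : TangentBundle (𝓡 n) N)) x₀) :
    ContinuousAt (fun x => coordDet n (F x₀) (F x) fun i => B i x) x₀ := by
  have h1 : ContinuousAt (fun x => Matrix.of fun i j =>
      tangentCoord n (F x₀) (F x) (B j x) i) x₀ := by
    refine continuousAt_pi.2 fun i => continuousAt_pi.2 fun j => ?_
    exact ((EuclideanSpace.proj (𝕜 := ℝ) i).continuous.continuousAt).comp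
      (continuousAt_tangentCoord (hB j))
  have h2 := (Continuous.matrix_det continuous_id).continuousAt.comp h1
  refine h2.congr (Filter.Eventually.of_forall fun x => ?_)
  simp only [coordDet, AlternatingMap.compLinearMap_apply, Module.Basis.det_apply]
  rfl

/-- A continuous local frame that is positively oriented at a point is so nearby. -/
theorem TangentOrientation.eventually_orientation_eq (o : TangentOrientation n N) {F : P → N}
    {x₀ : P} (hF : ContinuousAt F x₀) {B : Fin n → ∀ x, TangentSpace (𝓡 n) (F x)}
    (hB : ∀ i, ContinuousAt (fun x => (⟨F x, B i x⟩ : TangentBundle (𝓡 n) N)) x₀)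
    (w₀ : Module.Basis (Fin n) ℝ (TangentSpace (𝓡 n) (F x₀))) (hw₀ : ∀ i, w₀ i = B i x₀)
    (ho : w₀.orientation = o.orient (F x₀)) :
    ∀ᶠ x in nhds x₀, ∀ w : Module.Basis (Fin n) ℝ (TangentSpace (𝓡 n) (F x)),
      (∀ i, w i = B i x) → w.orientation = o.orient (F x) := by
  obtain ⟨U, b, hU, hb, hbo⟩ := o.continuous (F x₀)
  have hdom := mem_tangentDomain (n := n) (F x₀)
  have hD := continuousAt_coordDet (P := U) (F := fun y => (y : N)) (B := fun i y => b y i)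
    (x₀ := ⟨F x₀, hU⟩) fun i => (hb i).continuousAt
  have hw₀' : (fun i => B i x₀) = w₀ := funext fun i => (hw₀ i).symm
  -- The reference frame b and the frame B define the same orientation at x₀, so their coordinate
  -- determinants have the same sign there. Both signs persist nearby by continuity, which forces
  -- equal orientations.
  have hpos : 0 < coordDet n (F x₀) (F x₀) (b ⟨F x₀, hU⟩) *
      coordDet n (F x₀) (F x₀) fun i => B i x₀ := by
    rw [hw₀', coordDet_eq (F x₀) (b ⟨F x₀, hU⟩) w₀, ← mul_assoc]
    refine mul_pos (mul_self_pos.2 (coordDet_basis_ne_zero hdom _)) ?_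
    exact ((b ⟨F x₀, hU⟩).orientation_eq_iff_det_pos w₀).1 ((hbo _).trans ho.symm)
  have h1 : ∀ᶠ y : U in nhds ⟨F x₀, hU⟩, 0 < coordDet n (F x₀) (F x₀) (fun i => B i x₀) *
      coordDet n (F x₀) y fun i => b y i := by
    refine (hD.const_mul _).eventually (lt_mem_nhds ?_)
    exact hpos.trans_eq (mul_comm _ _)
  -- The frame b lives on the subtype U; this moves the estimate to neighbourhoods in N so that it
  -- can be pulled back along F.
  have h2 : ∀ᶠ y in nhds (F x₀), ∀ hy : y ∈ U, 0 <
      coordDet n (F x₀) (F x₀) (fun i => B i x₀) * coordDet n (F x₀) y fun i => b ⟨y, hy⟩ i := by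
    rw [← map_nhds_subtype_coe_eq_nhds hU (U.isOpen.mem_nhds hU), Filter.eventually_map]
    exact h1.mono fun y hy _ => hy
  have h3 : ∀ᶠ x in nhds x₀, 0 < coordDet n (F x₀) (F x₀) (fun i => B i x₀) *
      coordDet n (F x₀) (F x) fun i => B i x := by
    refine ((continuousAt_coordDet hB).const_mul _).eventually (lt_mem_nhds ?_)
    refine mul_self_pos.2 ?_
    rw [hw₀']
    exact coordDet_basis_ne_zero hdom _
  filter_upwards [hF.eventually h2, hF.eventually (U.isOpen.mem_nhds hU), h3]
    with x hx hxU hx' w hw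
  have hw' : (fun i => B i x) = w := funext fun i => (hw i).symm
  rw [← hbo ⟨F x, hxU⟩]
  refine ((b ⟨F x, hxU⟩).orientation_eq_iff_det_pos w).2 ?_ |>.symm
  rw [hw', coordDet_eq (F x₀) (b ⟨F x, hxU⟩) w, ← mul_assoc] at hx'
  exact pos_of_mul_pos_left (by rwa [mul_comm] at hx') (hx hxU).le

end Orientation

/-! ### From fields on manifolds to pointwise algebra. -/

section Bridge

variable {n : ℕ} {N : Type*} [TopologicalSpace N] [ChartedSpace (EuclideanSpace ℝ (Fin n)) N]
  [IsManifold (𝓡 n) ∞ N]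

/-- The metric on a tangent space as a bilinear form. -/
def PseudoRiemannianMetric.bilin (g : PseudoRiemannianMetric n N) (y : N) :
    TangentSpace (𝓡 n) y →ₗ[ℝ] TangentSpace (𝓡 n) y →ₗ[ℝ] ℝ :=
  LinearMap.mk₂ ℝ (fun v w => g.inner y v w) (by simp) (by simp) (by simp) (by simp)

theorem VectorCrossProduct.isVectorCross {g : PseudoRiemannianMetric n N} {r : ℕ}
    (X : VectorCrossProduct g r) (y : N) : IsVectorCross (g.bilin y) (X.toFun y) where
  symm := g.symm y
  nondegenerate := g.nondegenerate y
  orthogonal := X.orthogonal y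
  norm_sq := X.norm_sq y

variable {M : Type*} [TopologicalSpace M] [ChartedSpace (EuclideanSpace ℝ (Fin 6)) M]
  [IsManifold (𝓡 6) ∞ M]

/-- The differential as a linear map. -/
def differential (f : M → N) (x : M) :
    TangentSpace (𝓡 6) x →ₗ[ℝ] TangentSpace (𝓡 n) (f x) :=
  (mfderiv (𝓡 6) (𝓡 n) f x).toLinearMap

/-- The metric is definite of sign `ε` on the normal space at `x`. -/
def NormalDefinite (g : PseudoRiemannianMetric n N) (f : M → N) (x : M) (ε : ℝ) : Prop :=
  |ε| = 1 ∧ ∀ w ∈ normalSpace g f x, w ≠ 0 → 0 < ε * g.inner (f x) w w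

/-- Definiteness fixes the sign that orthonormality in absolute value leaves open. -/
theorem NormalDefinite.eq_of_abs {g : PseudoRiemannianMetric n N} {f : M → N} {x : M} {ε : ℝ}
    (h : NormalDefinite g f x ε) {w : TangentSpace (𝓡 n) (f x)} (hw : w ∈ normalSpace g f x)
    (h1 : |g.inner (f x) w w| = 1) : g.inner (f x) w w = ε := by
  have h2 : w ≠ 0 := fun h0 => by simp [h0] at h1
  have h3 := h.2 w hw h2
  rcases (abs_eq zero_le_one).1 h.1 with h4 | h4 <;>
    rcases (abs_eq zero_le_one).1 h1 with h5 | h5 <;> rw [h4, h5] at h3 ⊢ <;> linarith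

end Bridge

/-! ### Oriented normal frames as adapted frames. -/

section Frames

variable {k : ℕ} {N : Type*} [TopologicalSpace N]
  [ChartedSpace (EuclideanSpace ℝ (Fin (k + 6))) N] [IsManifold (𝓡 (k + 6)) ∞ N]
  {M : Type*} [TopologicalSpace M] [ChartedSpace (EuclideanSpace ℝ (Fin 6)) M]
  [IsManifold (𝓡 6) ∞ M] {g : PseudoRiemannianMetric (k + 6) N}
  {oN : TangentOrientation (k + 6) N} {oM : TangentOrientation 6 M} {f : M → N} {x : M}

theorem IsOrientedNormalFrame.exists_isAdapted {a : Fin k → TangentSpace (𝓡 (k + 6)) (f x)}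
    (h : IsOrientedNormalFrame g oN oM f x a) {ε : ℝ} (hε : NormalDefinite g f x ε) :
    ∃ (u : Module.Basis (Fin 6) ℝ (TangentSpace (𝓡 6) x))
      (w : Module.Basis (Fin (k + 6)) ℝ (TangentSpace (𝓡 (k + 6)) (f x))),
      u.orientation = oM.orient x ∧ w.orientation = oN.orient (f x) ∧
      IsAdapted (g.bilin (f x)) (differential f x) ε a u w := by
  obtain ⟨u, w, hu, hw, hc⟩ := h.oriented
  exact ⟨u, w, hu, hw, g.symm _, g.nondegenerate _, hε.1,
    fun i => hε.eq_of_abs (h.normal i) (h.unit i), h.orthogonal, fun i => h.normal i, hc⟩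

theorem IsAdapted.isOrientedNormalFrame {a : Fin k → TangentSpace (𝓡 (k + 6)) (f x)} {ε : ℝ}
    {u : Module.Basis (Fin 6) ℝ (TangentSpace (𝓡 6) x)}
    {w : Module.Basis (Fin (k + 6)) ℝ (TangentSpace (𝓡 (k + 6)) (f x))}
    (h : IsAdapted (g.bilin (f x)) (differential f x) ε a u w)
    (hu : u.orientation = oM.orient x) (hw : w.orientation = oN.orient (f x)) :
    IsOrientedNormalFrame g oN oM f x a where
  normal i := h.normal i
  orthogonal := h.orthogonal
  unit i := by
    have h1 : g.inner (f x) (a i) (a i) = ε := h.norm i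
    rw [h1, h.unit]
  oriented := ⟨u, w, hu, hw, h.coe_eq⟩

/-- The product with an oriented orthonormal frame does not depend on the frame. -/
theorem IsOrientedNormalFrame.cross_eq {a a' : Fin k → TangentSpace (𝓡 (k + 6)) (f x)}
    (h : IsOrientedNormalFrame g oN oM f x a) (h' : IsOrientedNormalFrame g oN oM f x a') {ε : ℝ}
    (hε : NormalDefinite g f x ε) (X : VectorCrossProduct g (k + 1))
    (z : TangentSpace (𝓡 (k + 6)) (f x)) :
    X.toFun (f x) (Fin.snoc (α := fun _ => TangentSpace (𝓡 (k + 6)) (f x)) a z) =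
      X.toFun (f x) (Fin.snoc (α := fun _ => TangentSpace (𝓡 (k + 6)) (f x)) a' z) := by
  obtain ⟨u, w, hu, hw, ha⟩ := h.exists_isAdapted hε
  obtain ⟨u', w', hu', hw', ha'⟩ := h'.exists_isAdapted hε
  refine sub_eq_zero.1 (g.nondegenerate _ _ fun y => ?_)
  -- For fixed z and y, a ↦ ⟨y, X(a, z)⟩ is alternating in a, so it agrees on the two frames.
  have h1 := ha.map_eq_map ha' (hw.trans hw'.symm) (hu.trans hu'.symm)
    ((X.isVectorCross (f x)).curryPairing z y)
  rw [IsVectorCross.curryPairing_apply, IsVectorCross.curryPairing_apply] at h1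
  rw [g.symm, map_sub, sub_eq_zero]
  exact h1

end Frames

/-! ### Smooth local oriented normal frames. -/

section LocalFrame

variable {m : ℕ} {N : Type*} [TopologicalSpace N]
  [ChartedSpace (EuclideanSpace ℝ (Fin (m + 1 + 6))) N] [IsManifold (𝓡 (m + 1 + 6)) ∞ N]
  {M : Type*} [TopologicalSpace M] [ChartedSpace (EuclideanSpace ℝ (Fin 6)) M]
  [IsManifold (𝓡 6) ∞ M] {g : PseudoRiemannianMetric (m + 1 + 6) N}
  {oN : TangentOrientation (m + 1 + 6) N} {oM : TangentOrientation 6 M} {f : M → N}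

theorem contDiffAt_inv_sqrt_abs {t : ℝ} (ht : t ≠ 0) :
    ContDiffAt ℝ ∞ (fun s : ℝ => (Real.sqrt |s|)⁻¹) t := by
  refine ContDiffAt.inv ?_ (Real.sqrt_ne_zero'.2 (abs_pos.2 ht))
  exact (Real.contDiffAt_sqrt (abs_pos.2 ht).ne').comp t (contDiffAt_abs ht)

/-- A smooth non-null field along a map can be normalized. -/
theorem contMDiffAt_normalize {x₀ : M} {v : ∀ x, TangentSpace (𝓡 (m + 1 + 6)) (f x)}
    (hv : ContMDiffAt (𝓡 6) (𝓡 (m + 1 + 6)).tangent ∞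
      (fun x => (⟨f x, v x⟩ : TangentBundle (𝓡 (m + 1 + 6)) N)) x₀)
    (h0 : g.inner (f x₀) (v x₀) (v x₀) ≠ 0) :
    ContMDiffAt (𝓡 6) (𝓡 (m + 1 + 6)).tangent ∞ (fun x => (⟨f x,
      (Real.sqrt |g.inner (f x) (v x) (v x)|)⁻¹ • v x⟩ : TangentBundle (𝓡 (m + 1 + 6)) N)) x₀ :=
  ContMDiffAt.smul_along ((contDiffAt_inv_sqrt_abs h0).contMDiffAt.comp x₀
    (f := fun x => g.inner (f x) (v x) (v x)) (g.contMDiffAt le_rfl hv hv)) hv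

theorem abs_inner_normalize {y : N} {v : TangentSpace (𝓡 (m + 1 + 6)) y}
    (h0 : g.inner y v v ≠ 0) :
    |g.inner y ((Real.sqrt |g.inner y v v|)⁻¹ • v) ((Real.sqrt |g.inner y v v|)⁻¹ • v)| = 1 := by
  have h1 := Real.mul_self_sqrt (abs_nonneg (g.inner y v v))
  have h2 : Real.sqrt |g.inner y v v| ≠ 0 := Real.sqrt_ne_zero'.2 (abs_pos.2 h0)
  simp only [map_smul, smul_apply, smul_eq_mul, abs_mul, abs_inv, abs_of_nonneg (Real.sqrt_nonneg _)]
  nth_rewrite 3 [← h1]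
  field_simp

theorem finrank_tangentSpace {n : ℕ} {N : Type*} [TopologicalSpace N]
    [ChartedSpace (EuclideanSpace ℝ (Fin n)) N] (y : N) :
    Module.finrank ℝ (TangentSpace (𝓡 n) y) = n :=
  (finrank_euclideanSpace_fin : Module.finrank ℝ (EuclideanSpace ℝ (Fin n)) = n)

/-- Around every point there is a smooth oriented orthonormal frame of the normal bundle that
starts with given vectors. -/
theorem exists_local_orientedNormalFrame (hm : m = 0 ∨ m = 1) (hf : IsImmersion6 (n := m + 1 + 6) f)
    (hdef : ∀ x, ∃ ε, NormalDefinite g f x ε) {e : ∀ x, TangentSpace (𝓡 (m + 1 + 6)) (f x)}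
    (he : ∀ x₀, ContMDiffAt (𝓡 6) (𝓡 (m + 1 + 6)).tangent ∞
      (fun x => (⟨f x, e x⟩ : TangentBundle (𝓡 (m + 1 + 6)) N)) x₀)
    (hen : ∀ x, e x ∈ normalSpace g f x) (he1 : ∀ x, |g.inner (f x) (e x) (e x)| = 1) (x₀ : M) :
    ∃ b : ∀ x, TangentSpace (𝓡 (m + 1 + 6)) (f x),
      ContMDiffAt (𝓡 6) (𝓡 (m + 1 + 6)).tangent ∞
        (fun x => (⟨f x, b x⟩ : TangentBundle (𝓡 (m + 1 + 6)) N)) x₀ ∧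
      ∀ᶠ x in nhds x₀, IsOrientedNormalFrame g oN oM f x
        (Fin.snoc (α := fun _ => TangentSpace (𝓡 (m + 1 + 6)) (f x)) (fun _ : Fin m => e x) (b x)) := by
  obtain ⟨ε₀, hε₀⟩ := hdef x₀
  -- At most one copy of e occurs in the frame, so no two copies have to be orthogonal.
  have hsub : ∀ i j : Fin m, i = j := fun i j => by omega
  obtain ⟨U, u', hU, -, hu'⟩ := oM.continuous x₀
  let u₀ := u' ⟨x₀, hU⟩
  have hu₀ : u₀.orientation = oM.orient x₀ := hu' ⟨x₀, hU⟩
  -- the frame at the point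
  obtain ⟨v₀, w₀, hw₀, had⟩ := exists_oriented_extension (g := g.bilin (f x₀))
    (A := differential f x₀) (hf.injective x₀) (g.symm _) (g.nondegenerate _) hε₀.1
    (fun w hw => hε₀.2 w hw) (p := fun _ : Fin m => e x₀)
    (fun _ => hε₀.eq_of_abs (hen x₀) (he1 x₀)) (fun i j hij => absurd (hsub i j) hij)
    (fun _ => hen x₀) u₀ (finrank_tangentSpace _) (oN.orient (f x₀))
  -- smooth fields that extend the frame at the point
  have hfx := hf.smooth.contMDiffAt (x := x₀)
  let u : Fin 6 → ∀ x, TangentSpace (𝓡 6) x := fun j x =>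
    tangentVec 6 x₀ x (tangentCoord 6 x₀ x₀ (u₀ j))
  have hu : ∀ j, ContMDiffAt (𝓡 6) (𝓡 6).tangent ∞
      (fun x => (⟨x, u j x⟩ : TangentBundle (𝓡 6) M)) x₀ := fun j =>
    (contMDiffOn_tangentVec x₀ _).contMDiffAt
      ((tangentDomain 6 x₀).isOpen.mem_nhds (mem_tangentDomain x₀))
  have hux₀ : ∀ j, u j x₀ = u₀ j := fun j => tangentVec_tangentCoord (mem_tangentDomain x₀) _
  have hdu : ∀ j, ContMDiffAt (𝓡 6) (𝓡 (m + 1 + 6)).tangent ∞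
      (fun x => (⟨f x, differential f x (u j x)⟩ : TangentBundle (𝓡 (m + 1 + 6)) N)) x₀ :=
    fun j => contMDiffAt_mfderiv_along (p := fun x => x) hf.smooth le_rfl (hu j)
  -- The extension of v₀ with constant coordinates is smooth, but need not be normal away from x₀;
  -- it only completes a local frame of the ambient tangent spaces.
  let c : ∀ x, TangentSpace (𝓡 (m + 1 + 6)) (f x) := fun x =>
    tangentVec (m + 1 + 6) (f x₀) (f x) (tangentCoord (m + 1 + 6) (f x₀) (f x₀) v₀)
  have hc : ContMDiffAt (𝓡 6) (𝓡 (m + 1 + 6)).tangent ∞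
      (fun x => (⟨f x, c x⟩ : TangentBundle (𝓡 (m + 1 + 6)) N)) x₀ :=
    contMDiffAt_along_comp hfx le_rfl (mem_tangentDomain _) (contMDiffOn_tangentVec _ _)
  have hcx₀ : c x₀ = v₀ := tangentVec_tangentCoord (mem_tangentDomain (f x₀)) _
  -- frames of the ambient tangent spaces with a given last normal vector
  let B : (∀ x, TangentSpace (𝓡 (m + 1 + 6)) (f x)) → Fin (m + 1 + 6) →
      ∀ x, TangentSpace (𝓡 (m + 1 + 6)) (f x) := fun b i x =>
    Fin.append (Fin.snoc (α := fun _ => TangentSpace (𝓡 (m + 1 + 6)) (f x))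
      (fun _ : Fin m => e x) (b x)) (fun j => differential f x (u j x)) i
  have hB : ∀ b, ContMDiffAt (𝓡 6) (𝓡 (m + 1 + 6)).tangent ∞
      (fun x => (⟨f x, b x⟩ : TangentBundle (𝓡 (m + 1 + 6)) N)) x₀ →
      ∀ i, ContMDiffAt (𝓡 6) (𝓡 (m + 1 + 6)).tangent ∞
        (fun x => (⟨f x, B b i x⟩ : TangentBundle (𝓡 (m + 1 + 6)) N)) x₀ := by
    intro b hb i
    induction i using Fin.addCases with
    | left i =>
      induction i using Fin.lastCases with
      | last => simpa only [B, Fin.append_left, Fin.snoc_last] using hb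
      | cast i => simpa only [B, Fin.append_left, Fin.snoc_castSucc] using he x₀
    | right i => simpa only [B, Fin.append_right] using hdu i
  have hBx₀ : ∀ b, b x₀ = v₀ → ∀ i, w₀ i = B b i x₀ := by
    intro b hb i
    rw [had.coe_eq]
    simp only [B, hb, hux₀]
    rfl
  -- the last normal vector before normalization
  obtain ⟨v, hv, hvB⟩ := g.exists_contMDiffAt hfx (hB c hc) w₀ (hBx₀ c hcx₀)
    -- The zeros make v orthogonal to e and to df(TM). The value ε₀ ≠ 0 against c keeps v from
    -- vanishing, and it is the value of v₀ at x₀.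
    (Fin.append (Fin.snoc (α := fun _ => ℝ) (fun _ : Fin m => 0) ε₀) fun _ : Fin 6 => 0)
  have hvx₀ : v x₀ = v₀ := by
    refine sub_eq_zero.1 (g.nondegenerate _ _ fun z => ?_)
    rw [g.symm, ← w₀.sum_repr z, map_sum, sum_apply]
    refine Finset.sum_eq_zero fun i _ => ?_
    rw [map_smul, smul_apply, map_sub, hBx₀ c hcx₀ i, hvB.self_of_nhds i, ← hBx₀ c hcx₀ i,
      had.coe_eq]
    suffices h : g.bilin (f x₀) (Fin.append (Fin.snoc
        (α := fun _ => TangentSpace (𝓡 (m + 1 + 6)) (f x₀)) (fun _ : Fin m => e x₀) v₀)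
        (differential f x₀ ∘ u₀) i) v₀ = Fin.append (Fin.snoc (α := fun _ => ℝ)
          (fun _ : Fin m => 0) ε₀) (fun _ : Fin 6 => 0) i by
      rw [← h]
      exact smul_eq_zero.2 (Or.inr (sub_self _))
    have hlast := had.norm (Fin.last m)
    rw [Fin.snoc_last] at hlast
    induction i using Fin.addCases with
    | left i =>
      induction i using Fin.lastCases with
      | last => simpa using hlast
      | cast i =>
        have := had.orthogonal i.castSucc (Fin.last m) (Fin.castSucc_lt_last i).ne
        simpa using this
    | right i =>
      have := had.normal (Fin.last m) (u₀ i)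
      rw [had.symm, Fin.snoc_last] at this
      simpa using this
  have hv₀ : g.inner (f x₀) v₀ v₀ = ε₀ := by
    have := had.norm (Fin.last m)
    rwa [Fin.snoc_last] at this
  let b : ∀ x, TangentSpace (𝓡 (m + 1 + 6)) (f x) := fun x =>
    (Real.sqrt |g.inner (f x) (v x) (v x)|)⁻¹ • v x
  have hb : ContMDiffAt (𝓡 6) (𝓡 (m + 1 + 6)).tangent ∞
      (fun x => (⟨f x, b x⟩ : TangentBundle (𝓡 (m + 1 + 6)) N)) x₀ :=
    contMDiffAt_normalize hv (by rw [hvx₀, hv₀]; exact had.ne_zero)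
  have hbx₀ : b x₀ = v₀ := by
    simp only [b, hvx₀, hv₀, hε₀.1]
    simp
  refine ⟨b, hb, ?_⟩
  filter_upwards [hvB, eventually_mem_tangentDomain (n := 6) (F := fun x : M => x) continuousAt_id,
    oN.eventually_orientation_eq hf.smooth.continuous.continuousAt
      (fun i => (hB b hb i).continuousAt) w₀ (hBx₀ b hbx₀) hw₀,
    oM.eventually_orientation_eq (F := fun x => x) continuousAt_id
      (fun i => (hu i).continuousAt) u₀ (fun i => (hux₀ i).symm) hu₀] with x hx hxd hxN hxM
  let ux : Module.Basis (Fin 6) ℝ (TangentSpace (𝓡 6) x) :=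
    (u₀.map (tangentEquiv (mem_tangentDomain x₀))).map (tangentEquiv hxd).symm
  have hux : ∀ j, ux j = u j x := fun j => rfl
  obtain ⟨ε, hε⟩ := hdef x
  have hvn : v x ∈ normalSpace g f x := fun z => by
    change g.inner (f x) (v x) (differential f x z) = 0
    rw [← ux.sum_repr z, map_sum, map_sum]
    refine Finset.sum_eq_zero fun j _ => ?_
    have := hx (Fin.natAdd (m + 1) j)
    simp only [B, Fin.append_right] at this
    rw [map_smul, map_smul, hux, g.symm, this, smul_zero]
  have hv0 : v x ≠ 0 := fun h0 => by
    have := hx (Fin.castAdd 6 (Fin.last m))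
    rw [h0, map_zero] at this
    simp only [Fin.append_left, Fin.snoc_last] at this
    exact had.ne_zero this.symm
  have hvv : g.inner (f x) (v x) (v x) ≠ 0 := fun h0 => by
    have := hε.2 _ hvn hv0
    simp [h0] at this
  have hbn : b x ∈ normalSpace g f x := (normalSpace g f x).smul_mem _ hvn
  have hev : ∀ i : Fin m, g.inner (f x) (e x) (b x) = 0 := fun i => by
    have := hx (Fin.castAdd 6 i.castSucc)
    simp only [B, Fin.append_left, Fin.snoc_castSucc] at this
    simp only [b, map_smul, this, smul_zero]
  have h1 : ∀ i : Fin (m + 1), g.bilin (f x)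
      (Fin.snoc (α := fun _ => TangentSpace (𝓡 (m + 1 + 6)) (f x)) (fun _ : Fin m => e x) (b x) i)
      (Fin.snoc (α := fun _ => TangentSpace (𝓡 (m + 1 + 6)) (f x)) (fun _ : Fin m => e x) (b x) i) =
      ε := fun i => by
    induction i using Fin.lastCases with
    | last =>
      rw [Fin.snoc_last]
      exact hε.eq_of_abs hbn (abs_inner_normalize hvv)
    | cast i =>
      rw [Fin.snoc_castSucc]
      exact hε.eq_of_abs (hen x) (he1 x)
  have h2 : ∀ i j : Fin (m + 1), i ≠ j → g.bilin (f x)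
      (Fin.snoc (α := fun _ => TangentSpace (𝓡 (m + 1 + 6)) (f x)) (fun _ : Fin m => e x) (b x) i)
      (Fin.snoc (α := fun _ => TangentSpace (𝓡 (m + 1 + 6)) (f x)) (fun _ : Fin m => e x) (b x) j) =
      0 := fun i j hij => by
    induction i using Fin.lastCases with
    | last =>
      induction j using Fin.lastCases with
      | last => exact absurd rfl hij
      | cast j =>
        rw [Fin.snoc_castSucc, Fin.snoc_last]
        exact (g.symm _ _ _).trans (hev j)
    | cast i =>
      induction j using Fin.lastCases with
      | last =>
        rw [Fin.snoc_castSucc, Fin.snoc_last]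
        exact hev i
      | cast j => exact absurd (congrArg Fin.castSucc (hsub i j)) hij
  have h3 : ∀ (i : Fin (m + 1)) z, g.bilin (f x)
      (Fin.snoc (α := fun _ => TangentSpace (𝓡 (m + 1 + 6)) (f x)) (fun _ : Fin m => e x) (b x) i)
      (differential f x z) = 0 := fun i z => by
    induction i using Fin.lastCases with
    | last =>
      rw [Fin.snoc_last]
      exact hbn z
    | cast i =>
      rw [Fin.snoc_castSucc]
      exact hen x z
  have hε0 : ε ≠ 0 := fun h0 => by simpa [h0] using hε.1
  obtain ⟨w, hw⟩ := exists_basis_append (A := differential f x) (hf.injective x)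
    (fun i => by rw [h1 i]; exact hε0) h2 h3 ux (finrank_tangentSpace _) (by omega)
  have hadx : IsAdapted (g.bilin (f x)) (differential f x) ε (Fin.snoc
      (α := fun _ => TangentSpace (𝓡 (m + 1 + 6)) (f x)) (fun _ : Fin m => e x) (b x)) ux w :=
    ⟨g.symm _, g.nondegenerate _, hε.1, h1, h2, h3, hw⟩
  exact hadx.isOrientedNormalFrame (hxM ux hux) (hxN w fun i => by rw [hw]; rfl)

end LocalFrame

/-! ### Gray's structure on the manifold and its Chern class. -/

section Gray

variable {m : ℕ} {N : Type*} [TopologicalSpace N]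
  [ChartedSpace (EuclideanSpace ℝ (Fin (m + 1 + 6))) N] [IsManifold (𝓡 (m + 1 + 6)) ∞ N]
  {M : Type*} [TopologicalSpace M] [ChartedSpace (EuclideanSpace ℝ (Fin 6)) M]
  [IsManifold (𝓡 6) ∞ M] {g : PseudoRiemannianMetric (m + 1 + 6) N}
  {oN : TangentOrientation (m + 1 + 6) N} {oM : TangentOrientation 6 M} {f : M → N}

/-- A trivial line bundle in a definite normal bundle is spanned by a smooth unit field. -/
theorem NormalContainsTrivialLine.exists_unit_field (h : NormalContainsTrivialLine g f)
    (hdef : ∀ x, ∃ ε, NormalDefinite g f x ε) :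
    ∃ e : ∀ x, TangentSpace (𝓡 (m + 1 + 6)) (f x),
      (∀ x₀, ContMDiffAt (𝓡 6) (𝓡 (m + 1 + 6)).tangent ∞
        (fun x => (⟨f x, e x⟩ : TangentBundle (𝓡 (m + 1 + 6)) N)) x₀) ∧
      (∀ x, e x ∈ normalSpace g f x) ∧ ∀ x, |g.inner (f x) (e x) (e x)| = 1 := by
  obtain ⟨φ, hinj, hmem, hφ⟩ := h
  have hne : ∀ x, g.inner (f x) (φ x 1) (φ x 1) ≠ 0 := fun x h0 => by
    obtain ⟨ε, hε⟩ := hdef x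
    have := hε.2 _ (hmem x 1) fun h1 => one_ne_zero (hinj x (h1.trans (map_zero (φ x)).symm))
    simp [h0] at this
  refine ⟨fun x => (Real.sqrt |g.inner (f x) (φ x 1) (φ x 1)|)⁻¹ • φ x 1, fun x₀ => ?_,
    fun x => (normalSpace g f x).smul_mem _ (hmem x 1), fun x => abs_inner_normalize (hne x)⟩
  refine contMDiffAt_normalize ?_ (hne x₀)
  exact hφ.contMDiffAt.comp x₀ (f := fun x : M => (x, (1 : ℝ)))
    (contMDiffAt_id.prodMk contMDiffAt_const)

/-- Existence of Gray's almost complex structure. -/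
theorem exists_isGrayStructure (hm : m = 0 ∨ m = 1) (hf : IsImmersion6 (n := m + 1 + 6) f)
    (X : VectorCrossProduct g (m + 1 + 1))
    (hdef : ∀ x, ∃ ε, NormalDefinite g f x ε ∧ ε ^ (m + 1) = 1)
    (hline : NormalContainsTrivialLine g f) :
    ∃ J : AlmostComplexStructure M, IsGrayStructure X oN oM f J := by
  have hdef' : ∀ x, ∃ ε, NormalDefinite g f x ε := fun x => (hdef x).imp fun _ h => h.1
  obtain ⟨e, he, hen, he1⟩ := hline.exists_unit_field hdef'
  have hloc := exists_local_orientedNormalFrame (oN := oN) (oM := oM) hm hf hdef' he hen he1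
  have hframe : ∀ x, ∃ a, IsOrientedNormalFrame g oN oM f x a := fun x => by
    obtain ⟨b, -, hb⟩ := hloc x
    exact ⟨_, hb.self_of_nhds⟩
  -- The frames a x and left inverses L x are chosen pointwise with no continuity. Smoothness of J
  -- comes later, from frame independence and the local smooth frames of `hloc`.
  choose a ha using hframe
  have hleft : ∀ x, ∃ L : TangentSpace (𝓡 (m + 1 + 6)) (f x) →ₗ[ℝ] TangentSpace (𝓡 6) x,
      L ∘ₗ differential f x = LinearMap.id := fun x =>
    LinearMap.exists_leftInverse_of_injective _ (LinearMap.ker_eq_bot.2 (hf.injective x))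
  choose L hL using hleft
  let J : ∀ x : M, EuclideanSpace ℝ (Fin 6) →L[ℝ] EuclideanSpace ℝ (Fin 6) := fun x =>
    LinearMap.toContinuousLinearMap (-(L x ∘ₗ lastPair (X.toFun (f x)) (fun i => a x i.castSucc)
      (a x (Fin.last m)) ∘ₗ differential f x) :
        TangentSpace (𝓡 6) x →ₗ[ℝ] TangentSpace (𝓡 6) x)
  have hJ : ∀ x (v : TangentSpace (𝓡 6) x), differential f x (J x v) =
      -X.toFun (f x) (Fin.snoc (α := fun _ => TangentSpace (𝓡 (m + 1 + 6)) (f x)) (a x)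
        (differential f x v)) := fun x v => by
    obtain ⟨ε, hε, -⟩ := hdef x
    obtain ⟨u, w, -, -, had⟩ := (ha x).exists_isAdapted hε
    obtain ⟨q, hq⟩ := had.exists_gray (X.isVectorCross (f x)) v
    have h1 : J x v = L x (-X.toFun (f x) (Fin.snoc
        (α := fun _ => TangentSpace (𝓡 (m + 1 + 6)) (f x)) (a x) (differential f x v))) := by
      rw [map_neg, apply_snoc_eq_lastPair]
      rfl
    rw [h1, ← hq]
    exact congrArg (differential f x) (LinearMap.congr_fun (hL x) q)
  have hcross : ∀ x a', IsOrientedNormalFrame g oN oM f x a' → ∀ z,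
      X.toFun (f x) (Fin.snoc (α := fun _ => TangentSpace (𝓡 (m + 1 + 6)) (f x)) (a x) z) =
      X.toFun (f x) (Fin.snoc (α := fun _ => TangentSpace (𝓡 (m + 1 + 6)) (f x)) a' z) :=
    fun x a' ha' z => by
      obtain ⟨ε, hε, -⟩ := hdef x
      exact (ha x).cross_eq ha' hε X z
  have hsq : ∀ (x : M) (v : TangentSpace (𝓡 6) x), J x (J x v) = -v := fun x v => by
    obtain ⟨ε, hε, hε'⟩ := hdef x
    obtain ⟨u, w, -, -, had⟩ := (ha x).exists_isAdapted hε
    have hG : IsGrayAt (differential f x) (X.toFun (f x)) (a x) (J x) := ⟨hJ x⟩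
    exact hG.sq had (X.isVectorCross (f x)) hm hε' (hf.injective x) v
  have hsmooth : ∀ x₀ : M, ContMDiffAt (𝓡 6)
      ((𝓡 6).prod 𝓘(ℝ, EuclideanSpace ℝ (Fin 6) →L[ℝ] EuclideanSpace ℝ (Fin 6))) ∞
      (fun x => TotalSpace.mk' (EuclideanSpace ℝ (Fin 6) →L[ℝ] EuclideanSpace ℝ (Fin 6))
        (E := fun x : M => TangentSpace (𝓡 6) x →L[ℝ] TangentSpace (𝓡 6) x) x (J x)) x₀ := by
    intro x₀
    obtain ⟨b, hb, hbx⟩ := hloc x₀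
    -- It suffices to test df ∘ J on constant-coordinate fields; near x₀ `hcross` replaces the
    -- chosen frame by the smooth one.
    refine contMDiffAt_endomorphism fun v => ?_
    refine contMDiffAt_of_mfderiv hf.smooth (hf.injective x₀) ?_
    have hdv : ContMDiffAt (𝓡 6) (𝓡 (m + 1 + 6)).tangent ∞ (fun x => (⟨f x,
        differential f x (tangentVec 6 x₀ x v)⟩ : TangentBundle (𝓡 (m + 1 + 6)) N)) x₀ :=
      contMDiffAt_mfderiv_along (p := fun x => x) hf.smooth le_rfl
      ((contMDiffOn_tangentVec x₀ v).contMDiffAt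
        ((tangentDomain 6 x₀).isOpen.mem_nhds (mem_tangentDomain x₀)))
    have h1 := ContMDiffAt.smul_along (c := fun _ => (-1 : ℝ)) contMDiffAt_const
      (X.contMDiffAt le_rfl hf.smooth.contMDiffAt
        (s := fun i x => Fin.snoc (α := fun _ => TangentSpace (𝓡 (m + 1 + 6)) (f x))
          (Fin.snoc (α := fun _ => TangentSpace (𝓡 (m + 1 + 6)) (f x)) (fun _ : Fin m => e x) (b x))
          (differential f x (tangentVec 6 x₀ x v)) i) (x₀ := x₀) fun i => by
        induction i using Fin.lastCases with
        | last => simpa only [Fin.snoc_last] using hdv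
        | cast i =>
          induction i using Fin.lastCases with
          | last => simpa only [Fin.snoc_last, Fin.snoc_castSucc] using hb
          | cast i => simpa only [Fin.snoc_castSucc] using he x₀)
    refine h1.congr_of_eventuallyEq ?_
    filter_upwards [hbx] with x hx
    rw [neg_one_smul]
    have h2 := hJ x (tangentVec 6 x₀ x v)
    rw [hcross x _ hx] at h2
    exact congrArg (fun z => (⟨f x, z⟩ : TangentBundle (𝓡 (m + 1 + 6)) N)) h2
  refine ⟨⟨J, hsq, hsmooth⟩, fun x a' ha' v => ?_⟩
  have h1 := hJ x v
  rw [hcross x a' ha'] at h1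
  exact h1

theorem AlmostComplexStructure.toReal_I_smul (J : AlmostComplexStructure M) (x : M)
    (v : J.CTangent x) : J.toReal x (Complex.I • v) = J.toFun x (J.toReal x v) := by
  rw [AlmostComplexStructure.toReal_smul]
  simp

theorem AlmostComplexStructure.toReal_ofReal_smul (J : AlmostComplexStructure M) (x : M) (r : ℝ)
    (v : J.CTangent x) : J.toReal x ((r : ℂ) • v) = r • J.toReal x v := by
  rw [AlmostComplexStructure.toReal_smul]
  simp

/-- The real part of the volume form is continuous on continuous fields. -/
theorem continuous_realVolume (hf : IsImmersion6 (n := m + 1 + 6) f)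
    (X : VectorCrossProduct g (m + 1 + 1)) {e : ∀ x, TangentSpace (𝓡 (m + 1 + 6)) (f x)}
    (he : ∀ x₀, ContMDiffAt (𝓡 6) (𝓡 (m + 1 + 6)).tangent ∞
      (fun x => (⟨f x, e x⟩ : TangentBundle (𝓡 (m + 1 + 6)) N)) x₀) {V : Opens M}
    {s t r : ∀ x : V, TangentSpace (𝓡 6) (x : M)}
    (hs : Continuous fun x : V => (⟨x, s x⟩ : TangentBundle (𝓡 6) M))
    (ht : Continuous fun x : V => (⟨x, t x⟩ : TangentBundle (𝓡 6) M))
    (hr : Continuous fun x : V => (⟨x, r x⟩ : TangentBundle (𝓡 6) M)) :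
    Continuous fun x : V => realVolume (g.bilin (f x)) (differential f (x : M)) (X.toFun (f x))
      (fun _ : Fin m => e x) (s x) (t x) (r x) := by
  -- The frames that define the determinant sheaf are only continuous, so the lemmas on fields along
  -- maps are used in order 0.
  have key : ∀ {q : ∀ x : V, TangentSpace (𝓡 6) (x : M)},
      Continuous (fun x : V => (⟨x, q x⟩ : TangentBundle (𝓡 6) M)) → ∀ x₀ : V,
      ContMDiffAt (𝓡 6) (𝓡 (m + 1 + 6)).tangent 0 (fun x : V =>
        (⟨f x, differential f (x : M) (q x)⟩ : TangentBundle (𝓡 (m + 1 + 6)) N)) x₀ :=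
    fun {q} hq x₀ => contMDiffAt_mfderiv_along (p := fun x : V => (x : M)) hf.smooth zero_le
      (contMDiff_zero_iff.2 hq).contMDiffAt
  have hcont : Continuous fun x : V => (x : M) := continuous_subtype_val
  have hfV : ∀ x₀ : V, ContMDiffAt (𝓡 6) (𝓡 (m + 1 + 6)) 0 (fun x : V => f x) x₀ := fun x₀ =>
    (contMDiff_zero_iff.2 (hf.smooth.continuous.comp hcont)).contMDiffAt
  have heV : ∀ x₀ : V, ContMDiffAt (𝓡 6) (𝓡 (m + 1 + 6)).tangent 0 (fun x : V =>
      (⟨f x, e x⟩ : TangentBundle (𝓡 (m + 1 + 6)) N)) x₀ := fun x₀ =>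
    (contMDiff_zero_iff.2 ((continuous_iff_continuousAt.2 fun x =>
      (he x).continuousAt).comp hcont)).contMDiffAt
  refine continuous_iff_continuousAt.2 fun x₀ => ?_
  refine (g.contMDiffAt zero_le (I := 𝓡 6) (F := fun x : V => f x)
    (X.contMDiffAt zero_le (hfV x₀)
      (s := fun i x => Fin.snoc (α := fun _ => TangentSpace (𝓡 (m + 1 + 6)) (f x))
        (Fin.snoc (α := fun _ => TangentSpace (𝓡 (m + 1 + 6)) (f x)) (fun _ : Fin m => e x)
          (differential f (x : M) (s x))) (differential f (x : M) (t x)) i) fun i => ?_)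
    (key hr x₀)).continuousAt
  induction i using Fin.lastCases with
  | last => simpa only [Fin.snoc_last] using key ht x₀
  | cast i =>
    induction i using Fin.lastCases with
    | last => simpa only [Fin.snoc_last, Fin.snoc_castSucc] using key hs x₀
    | cast i => simpa only [Fin.snoc_castSucc] using heV x₀

/-- The first Chern class of Gray's almost complex structure vanishes. -/
theorem IsGrayStructure.firstChernClass_eq_zero (hm : m = 0 ∨ m = 1)
    (hf : IsImmersion6 (n := m + 1 + 6) f) {X : VectorCrossProduct g (m + 1 + 1)}
    (hdef : ∀ x, ∃ ε, NormalDefinite g f x ε ∧ ε ^ (m + 1) = 1)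
    (hline : NormalContainsTrivialLine g f) {J : AlmostComplexStructure M}
    (hJ : IsGrayStructure X oN oM f J) : J.firstChernClass = 0 := by
  have hdef' : ∀ x, ∃ ε, NormalDefinite g f x ε := fun x => (hdef x).imp fun _ h => h.1
  obtain ⟨e, he, hen, he1⟩ := hline.exists_unit_field hdef'
  -- The last frame vector is available only locally, but the first m are always e. Pointwise frames
  -- thus prove identities for the form φ below, which depends on e alone and so is global.
  have hframe : ∀ x, ∃ (ε : ℝ) (a : Fin (m + 1) → TangentSpace (𝓡 (m + 1 + 6)) (f x))
      (u : Module.Basis (Fin 6) ℝ (TangentSpace (𝓡 6) x))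
      (w : Module.Basis (Fin (m + 1 + 6)) ℝ (TangentSpace (𝓡 (m + 1 + 6)) (f x))),
      IsAdapted (g.bilin (f x)) (differential f x) ε a u w ∧ ε ^ (m + 1) = 1 ∧
      (fun i : Fin m => a i.castSucc) = (fun _ => e x) ∧
      IsGrayAt (differential f x) (X.toFun (f x)) a (J.toFun x) := fun x => by
    obtain ⟨b, -, hb⟩ :=
      exists_local_orientedNormalFrame (oN := oN) (oM := oM) hm hf hdef' he hen he1 x
    obtain ⟨ε, hε, hε'⟩ := hdef x
    obtain ⟨u, w, -, -, had⟩ := hb.self_of_nhds.exists_isAdapted hε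
    exact ⟨ε, _, u, w, had, hε', funext fun i => Fin.snoc_castSucc (α := fun _ => _) _ _ i,
      ⟨hJ x _ hb.self_of_nhds⟩⟩
  let φ : ∀ x, J.CTangent x → J.CTangent x → J.CTangent x → ℝ := fun x u v w =>
    realVolume (g.bilin (f x)) (differential f x) (X.toFun (f x)) (fun _ : Fin m => e x)
      (J.toReal x u) (J.toReal x v) (J.toReal x w)
  have h12 : ∀ x u v w, φ x u v w = -φ x v u w := fun x u v w => by
    obtain ⟨ε, a, u', w', had, -, hae, -⟩ := hframe x
    have := had.realVolume_swap₁₂ (X.isVectorCross (f x)) hm (J.toReal x u) (J.toReal x v)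
      (J.toReal x w)
    rwa [hae] at this
  have h23 : ∀ x u v w, φ x u v w = -φ x u w v := fun x u v w => by
    obtain ⟨ε, a, u', w', had, -, hae, -⟩ := hframe x
    have := had.realVolume_swap₂₃ (X.isVectorCross (f x)) hm (J.toReal x u) (J.toReal x v)
      (J.toReal x w)
    rwa [hae] at this
  have hI : ∀ x u v w, φ x (Complex.I • u) v w = φ x u (Complex.I • v) w := fun x u v w => by
    obtain ⟨ε, a, u', w', had, -, hae, hG⟩ := hframe x
    have := hG.realVolume_middle had (X.isVectorCross (f x)) hm (J.toReal x u) (J.toReal x v)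
      (J.toReal x w)
    rw [hae] at this
    simp only [φ, J.toReal_I_smul]
    exact this
  have hne : ∀ x, ∃ u v w, φ x u v w ≠ 0 := fun x => by
    obtain ⟨ε, a, u', w', had, hε, hae, -⟩ := hframe x
    obtain ⟨u, v, w, h⟩ := had.exists_realVolume_ne_zero (X.isVectorCross (f x)) hm hε
      (hf.injective x) (by norm_num)
    rw [hae] at h
    exact ⟨(J.toReal x).symm u, (J.toReal x).symm v, (J.toReal x).symm w, h⟩
  have hadd : ∀ x u u' v w, φ x (u + u') v w = φ x u v w + φ x u' v w := fun x u u' v w => by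
    simp [φ, realVolume]
  have hsmul : ∀ x (r : ℝ) u v w, φ x ((r : ℂ) • u) v w = r * φ x u v w := fun x r u v w => by
    simp only [φ, realVolume, J.toReal_ofReal_smul]
    simp
  refine J.firstChernClass_eq_zero_of_volumeForm
    (fun x => complexVolumeForm (φ x) (hadd x) (hsmul x) (h12 x) (h23 x) (hI x))
    (fun x b => complexVolumeForm_ne_zero _ _ _ _ _ _ (hne x) b) fun V b hb => ?_
  -- The imaginary part of the volume form evaluates φ with i • b 0 in the first slot, a continuous
  -- field because J is smooth.
  have hJb : Continuous fun x : V =>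
      (⟨x, J.toReal (x : M) (Complex.I • b x 0)⟩ : TangentBundle (𝓡 6) M) := by
    simp only [J.toReal_I_smul]
    exact continuous_iff_continuousAt.2 fun x =>
      ContinuousAt.clm_bundle_apply (ϕ := fun y : V => J.toFun y)
        (ContinuousAt.comp (f := fun y : V => (y : M)) J.smooth.continuous.continuousAt
          continuous_subtype_val.continuousAt) (hb 0).continuousAt
  simp only [complexVolumeForm_apply]
  exact (Complex.continuous_ofReal.comp (continuous_realVolume hf X he (hb 0) (hb 1) (hb 2))).sub
    (continuous_const.mul
      (Complex.continuous_ofReal.comp (continuous_realVolume hf X he hJb (hb 1) (hb 2))))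

end Gray

end GrayChern

end

/-! ### The main theorem. -/

theorem mainTheorem10 {k : ℕ} (hk : k = 1 ∨ k = 2)
    {M : Type*} [TopologicalSpace M] [ChartedSpace (EuclideanSpace ℝ (Fin 6)) M]
    [IsManifold (𝓡 6) ∞ M] [T2Space M] [SecondCountableTopology M]
    {N : Type*} [TopologicalSpace N] [ChartedSpace (EuclideanSpace ℝ (Fin (k + 6))) N]
    [IsManifold (𝓡 (k + 6)) ∞ N] [T2Space N] [SecondCountableTopology N]
    (oM : GrayChern.TangentOrientation 6 M) (oN : GrayChern.TangentOrientation (k + 6) N)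
    (g : GrayChern.PseudoRiemannianMetric (k + 6) N)
    (X : GrayChern.VectorCrossProduct g (k + 1))
    (f : M → N) (hf : GrayChern.IsImmersion6 (n := k + 6) f)
    (hdef : ∀ x, GrayChern.NormalPosDef g f x ∨ (k = 2 ∧ GrayChern.NormalNegDef g f x))
    (hline : GrayChern.NormalContainsTrivialLine g f) :
    (∃ J : GrayChern.AlmostComplexStructure M, GrayChern.IsGrayStructure X oN oM f J) ∧
    ∀ J : GrayChern.AlmostComplexStructure M, GrayChern.IsGrayStructure X oN oM f J →
      J.firstChernClass = 0 := by
  obtain ⟨m, rfl, hm⟩ : ∃ m, k = m + 1 ∧ (m = 0 ∨ m = 1) := by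
    rcases hk with rfl | rfl
    · exact ⟨0, rfl, Or.inl rfl⟩
    · exact ⟨1, rfl, Or.inr rfl⟩
  have hdef' : ∀ x, ∃ ε, GrayChern.NormalDefinite g f x ε ∧ ε ^ (m + 1) = 1 := fun x => by
    rcases hdef x with h | ⟨hm', h⟩
    · exact ⟨1, ⟨by simp, fun w hw hw0 => by simpa using h w hw hw0⟩, by simp⟩
    -- Negative sign is admissible because here k = 2 and (-1)^2 = 1.
    · refine ⟨-1, ⟨by simp, fun w hw hw0 => by simpa using h w hw hw0⟩, ?_⟩
      rw [hm']
      norm_num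
  exact ⟨GrayChern.exists_isGrayStructure hm hf X hdef' hline,
    fun J hJ => hJ.firstChernClass_eq_zero hm hf hdef' hline⟩
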